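/- **Theorem (Structure Theorem for $k$-means).** There is an absolute constant $C>0$, and for every $d\ge 1$ there are constants $c,K>0$ depending only on $d$, such that the following holds for all $0<\varepsilon\le 1/2$, all $0<\rho\le c\,\varepsilon/\log(1/\varepsilon)$ and all integers $m\le M$. *Quadtree.* Let $u$ be uniform in $[0,1)^d$ and let $\mathcal D$ be the randomly shifted quadtree of $\mathbb R^d$ with levels $m,\dots,M$: level $M$ is a single cell (the root), and for $m\le i<M$ the cells of level $i$ are the half-open cubes $a+\ell_i(z+[0,1)^d)$, $z\in\mathbb Z^d$, of side $\ell_i=2^{i+1}/\sqrt d$ (hence diameter $2^{i+1}$), where $a=\ell_M u$. The portals of a cell of level $i<M$ are the points of its boundary that lie on the grid $a+\frac{\ell_i}{\lceil 1/\rho\rceil}\mathbb Z^d$. A set is *cut at level $i$* if $i$ is the largest level at which it is not contained in a single cell; the level is $-\infty$ (and $2^{-\infty}=0$) if there is no such level. $\mathrm{level}(x,r)$ is the level at which the closed ball $B(x,r)$ is cut. *Instance.* Let $P,\mathcal C\subset\mathbb R^d$ be finite sets (clients, candidate centers) and $k\ge1$. A solution is a set $S\subseteq\mathcal C$ with $|S|=k$.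 For a finite nonempty set $S$ of centers, $S(p)$ is the center of $S$ closest to $p$ (fixed arbitrary tie-breaking), $S_p=\mathrm{dist}(p,S)$, and $\mathrm{cost}(P,S)=\sum_{p\in P}S_p^2$. Let $\mathrm{OPT}$ be a solution of minimal cost and $\mathcal A$ any solution. *Trimmed optimum.* For $\ell\in\mathcal A$ let $\psi(\ell)=\{f\in \mathrm{OPT}:\mathcal A(f)=\ell\}$, and let $\mathrm{OPT}^{\ge2}=\{f\in\mathrm{OPT}:|\psi(\mathcal A(f))|\ge2\}$. A trimmed optimum is a set $\mathrm{OPT}'=\mathrm{OPT}\setminus\mathcal H$ with $\mathcal H\subseteq\mathrm{OPT}^{\ge2}$, $|\mathcal H|=\lfloor\varepsilon|\mathrm{OPT}^{\ge2}|/2\rfloor$, such that for each $\ell\in\mathcal A$ with $\psi(\ell)\neq\emptyset$ a center of $\psi(\ell)$ closest to $\ell$ is not in $\mathcal H$, and $\mathrm{cost}(P,\mathrm{OPT}')\le(1+C\varepsilon)\,\mathrm{cost}(P,\mathrm{OPT})+C\varepsilon\,\mathrm{cost}(P,\mathcal A)$. *Badly cut, budget.* Put $\delta=2\rho$ and $\tau=\log_2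 d+\log_2(1/\delta)$. The ball $B(x,r)$ is badly cut if it is cut and $\mathrm{level}(x,r)\ge\log_2 r+\tau$. Let $\tilde p=\mathcal A(p)$ if $B(p,3\mathcal A_p)$ is badly cut and $\tilde p=p$ otherwise; let $B_{\mathcal D}$ be the set of $\ell\in\mathcal A$ for which $B(\ell,3\mathrm{OPT}'_\ell)$ is badly cut. Let $\mathrm{det}(x,r)=\delta 2^{\mathrm{level}(x,r)}r+\delta^2 2^{2\,\mathrm{level}(x,r)}$. The budget of $p$ is $b(p)=b_1+b_2+b_3$, where $b_1,b_2,b_3$ are $\mathrm{det}(x,r)$ for the balls $B(x,r)=B(p,3\mathcal A_p)$, $B(p,3(\mathcal A_p+\mathrm{OPT}'_p))$, $B(\mathcal A(p),3\mathrm{OPT}'_{\mathcal A(p)})$ respectively if that ball is not cut or $\mathrm{level}(x,r)\le\log_2 r+\tau$; otherwise $b_1=0$, $b_2=36d\mathcal A_p^2+16d(\mathrm{OPT}'_p)^2$, $b_3=0$. *Conclusion.* (a) For every shift, every cell of every level $m\le i<M$ has at most $K/\rho^{d-1}$ portals (so $O_d((\log(1/\varepsilon)/\varepsilon)^{d-1})$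 portals for $\rho=c\,\varepsilon/\log(1/\varepsilon)$); for every $x$ in the cell and $q$ outside it the cell has a portal $y$ with $\|x-y\|+\|y-q\|\le\|x-q\|+\rho2^{i+1}$; and every portal of a cell of level $i+1$ lying in the closure of a level-$i$ cell inside that cell is a portal of the latter. (b) A trimmed optimum exists. (c) For every trimmed optimum $\mathrm{OPT}'$, with probability at least $2/3$ over the shift, $\mathcal D$ has $\varepsilon$-small distortion, that is: 1. $\sum_{p\in P}b(p)\le\varepsilon\,(\mathrm{cost}(P,\mathrm{OPT})+\mathrm{cost}(P,\mathcal A))$; 2. there is a solution $S^*\supseteq B_{\mathcal D}$ with $\sum_{p\in P}(\mathrm{dist}(p,\tilde p)+\mathrm{dist}(\tilde p,S^*))^2\le(1+\varepsilon)\,\mathrm{cost}(P,\mathrm{OPT})+\varepsilon\,\mathrm{cost}(P,\mathcal A)$; 3. for every $p\in P$ there is $s\in S^*$ such that, if $i$ is the level at which $\{\tilde p,s\}$ is cut, $(\mathrm{dist}(p,\tilde p)+\mathrm{dist}(\tilde p,s)+\rho2^i)^2\le(\mathrm{dist}(p,\tilde p)+\mathrm{dist}(\tilde p,S^*))^2+b(p)$.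 -/

import Mathlib

open scoped BigOperators

namespace QT

/-- Points of `ℝ^d` with the Euclidean metric. -/
abbrev Pt (d : ℕ) : Type := EuclideanSpace ℝ (Fin d)

/-! ### Clustering -/

/-- `dist(p, S)`, the distance from `p` to its closest point in `S`
(used for nonempty `S` only). -/
noncomputable def distTo {d : ℕ} (S : Finset (Pt d)) (p : Pt d) : ℝ :=
  Metric.infDist p (S : Set (Pt d))

/-- The `k`-means cost. -/
noncomputable def cost {d : ℕ} (P S : Finset (Pt d)) : ℝ :=
  ∑ p ∈ P, distTo S p ^ 2

/-- A solution is a set of exactly `k` candidate centers. -/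
def IsSolution {d : ℕ} (Cand : Finset (Pt d)) (k : ℕ) (S : Finset (Pt d)) : Prop :=
  S ⊆ Cand ∧ S.card = k

/-- A solution of minimal cost. -/
def IsOptimal {d : ℕ} (P Cand : Finset (Pt d)) (k : ℕ) (S : Finset (Pt d)) : Prop :=
  IsSolution Cand k S ∧ ∀ T, IsSolution Cand k T → cost P S ≤ cost P T

/-- `α` is a nearest-center map `x ↦ A(x)` of `A`, with some choice of tie-breaking. -/
def IsNearestMap {d : ℕ} (A : Finset (Pt d)) (α : Pt d → Pt d) : Prop :=
  ∀ x, α x ∈ A ∧ ∀ a ∈ A, dist x (α x) ≤ dist x a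

/-! ### Hierarchical decompositions -/

/-- A hierarchical decomposition: partitions, one for each level from `bot` to `top`, each one
refining the next. The parts of the level-`i` partition are the classes of `part i`. -/
structure HierDecomp (X : Type*) where
  bot : ℤ
  top : ℤ
  part : ℤ → Setoid X
  refines : ∀ i, bot ≤ i → i < top → part i ≤ part (i + 1)

namespace HierDecomp

variable {X : Type*} (D : HierDecomp X)

/-- The part of level `i` that contains `x`. -/
def cell (i : ℤ) (x : X) : Set X := {y | D.part i y x}

/-- The level-`i` partition separates two points of `T`. -/
def Separates (i : ℤ) (T : Set X) : Prop := ∃ x ∈ T, ∃ y ∈ T, ¬ D.part i x y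

open scoped Classical in
/-- The level at which a set is cut: the highest level that separates two of its points, and
`⊥` (that is, `-∞`) if the set is not cut. -/
noncomputable def level (T : Set X) : WithBot ℤ :=
  ((Finset.Icc D.bot D.top).filter fun i => D.Separates i T).max

end HierDecomp

/-- `2 ^ l` for a level `l`, with `2 ^ (-∞) = 0`. -/
noncomputable def pow2 (l : WithBot ℤ) : ℝ :=
  WithBot.recBotCoe (C := fun _ => ℝ) 0 (fun i : ℤ => (2 : ℝ) ^ i) l

/-! ### The randomly shifted quadtree and its portals -/

/-- Side length of the cells of level `i`; these cells have diameter `2 ^ (i + 1)`. -/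
noncomputable def side (d : ℕ) (i : ℤ) : ℝ := (2 : ℝ) ^ (i + 1) / Real.sqrt d

/-- The corner from which all the grids of the quadtree are laid out, for the shift `u`. -/
noncomputable def origin (d : ℕ) (top : ℤ) (u : Fin d → ℝ) (j : Fin d) : ℝ := side d top * u j

/-- Integer coordinates of the cube of level `i` that contains `x`. -/
noncomputable def cubeIndex {d : ℕ} (top : ℤ) (u : Fin d → ℝ) (i : ℤ) (x : Pt d) (j : Fin d) : ℤ :=
  ⌊(x j - origin d top u j) / side d i⌋

theorem side_succ (d : ℕ) (i : ℤ) : side d (i + 1) = side d i * 2 := by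
  unfold side
  rw [zpow_add_one₀ (by norm_num : (2 : ℝ) ≠ 0) (i + 1)]
  ring

/-- The quadtree with levels `bot, …, top` and shift `u`: the root (level `top`) is one single
part, and below it level `i` consists of the half-open cubes of side `side d i`, each of which
is split into `2 ^ d` cubes of half the side at the next lower level. -/
noncomputable def quadtree (d : ℕ) (bot top : ℤ) (u : Fin d → ℝ) : HierDecomp (Pt d) where
  bot := bot
  top := top
  part i := if i < top then Setoid.ker (cubeIndex top u i) else ⊤
  refines i _ hi := by
    rw [if_pos hi]
    split_ifs with h
    · intro x y hxy
      have hxy' : cubeIndex top u i x = cubeIndex top u i y := hxy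
      change cubeIndex top u (i + 1) x = cubeIndex top u (i + 1) y
      funext j
      have hj := congrFun hxy' j
      unfold cubeIndex at hj ⊢
      rw [side_succ, ← div_div, ← div_div]
      have key : ∀ a : ℝ, ⌊a / 2⌋ = ⌊a⌋ / 2 := fun a => by
        have := Int.floor_div_natCast a 2
        simpa using this
      rw [key, key, hj]
    · exact le_top

/-- The law of the shift: independent coordinates, uniform in `[0, 1)`. -/
noncomputable def shiftLaw (d : ℕ) : MeasureTheory.Measure (Fin d → ℝ) :=
  MeasureTheory.Measure.pi fun _ => MeasureTheory.volume.restrict (Set.Ico (0 : ℝ) 1)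

/-- The portals, with portal parameter `ρ`, of the level-`i` cell that contains `x`: the points
on the boundary of the cell that lie on the regular grid which divides every edge of a cube of
level `i` into `⌈1 / ρ⌉` pieces of equal length. -/
noncomputable def portals (d : ℕ) (bot top : ℤ) (u : Fin d → ℝ) (ρ : ℝ) (i : ℤ) (x : Pt d) :
    Set (Pt d) :=
  {y | y ∈ frontier ((quadtree d bot top u).cell i x) ∧
    ∃ w : Fin d → ℤ, ∀ j, y j = origin d top u j + side d i / (⌈1 / ρ⌉₊ : ℝ) * w j}

/-- The portals with parameter `ρ` are at most `K / ρ ^ (d - 1)` per cell; for every `x` in a cell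
of level `i` and every `q` outside there is a portal of the cell that is a detour of at most
`ρ 2 ^ (i + 1)` on the way from `x` to `q`; and a portal of level `i + 1` that lies on a cell
inside is a portal of that cell too. -/
def GoodPortals (d : ℕ) (bot top : ℤ) (u : Fin d → ℝ) (ρ K : ℝ) : Prop :=
  ∀ i : ℤ, bot ≤ i → i < top → ∀ x : Pt d,
    ((portals d bot top u ρ i x).Finite ∧
      ((portals d bot top u ρ i x).ncard : ℝ) ≤ K / ρ ^ (d - 1)) ∧
    (∀ q, q ∉ (quadtree d bot top u).cell i x →
      ∃ y ∈ portals d bot top u ρ i x, dist x y + dist y q ≤ dist x q + ρ * (2 : ℝ) ^ (i + 1)) ∧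
    (∀ y ∈ portals d bot top u ρ (i + 1) x,
      y ∈ closure ((quadtree d bot top u).cell i x) → y ∈ portals d bot top u ρ i x)

/-! ### Badly cut balls and budgets

In this part `δ` is the parameter of the budget. -/

/-- `τ(δ, d) = log d + log (1 / δ)`, logarithms to base 2. -/
noncomputable def tau (δ : ℝ) (d : ℕ) : ℝ := Real.logb 2 d + Real.logb 2 (1 / δ)

/-- The level at which `B(x, r)` is cut. -/
noncomputable def ballLevel {d : ℕ} (D : HierDecomp (Pt d)) (x : Pt d) (r : ℝ) : WithBot ℤ :=
  D.level (Metric.closedBall x r)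

/-- `level(x, r) ≥ log r + τ(δ, d)`; a ball that is not cut (in particular one of radius `0`)
is not badly cut. -/
def BadlyCut {d : ℕ} (D : HierDecomp (Pt d)) (δ : ℝ) (x : Pt d) (r : ℝ) : Prop :=
  ∃ i : ℤ, ballLevel D x r = i ∧ Real.logb 2 r + tau δ d ≤ i

/-- `level(x, r) ≤ log r + τ(δ, d)`; this holds for a ball that is not cut. -/
def LevelLe {d : ℕ} (D : HierDecomp (Pt d)) (δ : ℝ) (x : Pt d) (r : ℝ) : Prop :=
  ∀ i : ℤ, ballLevel D x r = i → (i : ℝ) ≤ Real.logb 2 r + tau δ d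

/-- The detour of a ball. -/
noncomputable def det {d : ℕ} (D : HierDecomp (Pt d)) (δ : ℝ) (x : Pt d) (r : ℝ) : ℝ :=
  δ * pow2 (ballLevel D x r) * r + δ ^ 2 * pow2 (ballLevel D x r) ^ 2

open scoped Classical in
noncomputable def b₁ {d : ℕ} (D : HierDecomp (Pt d)) (δ : ℝ) (A : Finset (Pt d)) (p : Pt d) : ℝ :=
  if LevelLe D δ p (3 * distTo A p) then det D δ p (3 * distTo A p) else 0

open scoped Classical in
noncomputable def b₂ {d : ℕ} (D : HierDecomp (Pt d)) (δ : ℝ) (A S : Finset (Pt d)) (p : Pt d) : ℝ :=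
  if LevelLe D δ p (3 * (distTo A p + distTo S p)) then det D δ p (3 * (distTo A p + distTo S p))
  else 36 * d * distTo A p ^ 2 + 16 * d * distTo S p ^ 2

open scoped Classical in
noncomputable def b₃ {d : ℕ} (D : HierDecomp (Pt d)) (δ : ℝ) (α : Pt d → Pt d) (S : Finset (Pt d))
    (p : Pt d) : ℝ :=
  if LevelLe D δ (α p) (3 * distTo S (α p)) then det D δ (α p) (3 * distTo S (α p)) else 0

/-- The budget of `p` with respect to `A` (with nearest-center map `α`) and `S`. -/
noncomputable def budget {d : ℕ} (D : HierDecomp (Pt d)) (δ : ℝ) (A : Finset (Pt d))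
    (α : Pt d → Pt d) (S : Finset (Pt d)) (p : Pt d) : ℝ :=
  b₁ D δ A p + b₂ D δ A S p + b₃ D δ α S p

open scoped Classical in
/-- The moved point: `A(p)` if `p` is badly cut with respect to `A`, and `p` otherwise. -/
noncomputable def moved {d : ℕ} (D : HierDecomp (Pt d)) (δ : ℝ) (A : Finset (Pt d))
    (α : Pt d → Pt d) (p : Pt d) : Pt d :=
  if BadlyCut D δ p (3 * distTo A p) then α p else p

open scoped Classical in
/-- The centers of `A` that are badly cut with respect to `S`. -/
noncomputable def badCenters {d : ℕ} (D : HierDecomp (Pt d)) (δ : ℝ) (A S : Finset (Pt d)) :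
    Finset (Pt d) :=
  A.filter fun a => BadlyCut D δ a (3 * distTo S a)

/-! ### The trimmed optimum -/

open scoped Classical in
/-- The centers of `O` whose closest center of `A` is `l`. -/
noncomputable def fiber {d : ℕ} (O : Finset (Pt d)) (α : Pt d → Pt d) (l : Pt d) : Finset (Pt d) :=
  O.filter fun f => α f = l

open scoped Classical in
/-- The centers `f` of `O` such that at least two centers of `O` are mapped to `A(f)`. -/
noncomputable def multi {d : ℕ} (O : Finset (Pt d)) (α : Pt d → Pt d) : Finset (Pt d) :=
  O.filter fun f => 2 ≤ (fiber O α (α f)).card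

open scoped Classical in
/-- `O'` arises from `O` by removing `⌊ε |multi| / 2⌋` centers of `multi`, in such a way that for
every center `l` of `A` a closest center among those mapped to `l` is kept, and that the cost is at
most `(1 + C ε) cost(O) + C ε cost(A)`. -/
def IsTrimmed {d : ℕ} (C ε : ℝ) (P O A : Finset (Pt d)) (α : Pt d → Pt d)
    (O' : Finset (Pt d)) : Prop :=
  ∃ H : Finset (Pt d), H ⊆ multi O α ∧ O' = O \ H ∧
    H.card = ⌊ε * (multi O α).card / 2⌋₊ ∧
    (∀ l ∈ A, (fiber O α l).Nonempty →
      ∃ f ∈ fiber O α l, f ∉ H ∧ ∀ g ∈ fiber O α l, dist l f ≤ dist l g) ∧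
    cost P O' ≤ (1 + C * ε) * cost P O + C * ε * cost P A

/-! ### Small distortion -/

/-- `ε`-small distortion, for the instance `(P, Cand, k)` with optimum `O`, trimmed optimum `O'` and
solution `A`. Here `δ` is the parameter of the budget and `ρ` the portal parameter, so that
connecting two points cut at level `i` costs a detour `ρ 2 ^ i`. -/
def SmallDistortion {d : ℕ} (D : HierDecomp (Pt d)) (ε δ ρ : ℝ) (P Cand : Finset (Pt d)) (k : ℕ)
    (O O' A : Finset (Pt d)) (α : Pt d → Pt d) : Prop :=
  ∑ p ∈ P, budget D δ A α O' p ≤ ε * (cost P O + cost P A) ∧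
  ∃ S : Finset (Pt d), IsSolution Cand k S ∧ badCenters D δ A O' ⊆ S ∧
    ∑ p ∈ P, (dist p (moved D δ A α p) + distTo S (moved D δ A α p)) ^ 2
      ≤ (1 + ε) * cost P O + ε * cost P A ∧
    ∀ p ∈ P, ∃ s ∈ S,
      (dist p (moved D δ A α p) + dist (moved D δ A α p) s
          + ρ * pow2 (D.level {moved D δ A α p, s})) ^ 2
        ≤ (dist p (moved D δ A α p) + distTo S (moved D δ A α p)) ^ 2 + budget D δ A α O' p

end QT

namespace QT

open MeasureTheory

/-! ### Portals -/

/-! Everything probabilistic rests on one expectation. Below the root, the number of level-`i` grid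
hyperplanes meeting `B(x, r)` (`cutCount`) has mean exactly `d √d r / 2 ^ i`, because the shift
places each coordinate of the grid uniformly modulo its mesh. As the grids are nested, a ball cut at
level `l` meets every grid of level at most `l`, so this count dominates indicators of cuts. Badly
cut means `2 ^ level ≥ r d / δ`, hence has probability at most `√d δ`. For a ball that is not badly
cut, only about `1 + τ` levels above `log r` matter, and each contributes `O(r)` to the mean of `2 ^
level`. So the expected detour is `O(δ (1 + τ) r ^ 2)`, and `exists_parameter` makes `δ (1 + τ)` a
small multiple of `ε`.

The solution `S*` is an exchange (`exists_exchange`). The badly cut centers `B` of `A` enter the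
optimum `O`. A center of `B` with exactly one optimal center in its fiber replaces that one. As `|O|
= |A|`, the other centers of `A` number exactly `|multi|`, and with good probability at most `ε
|multi| / 144` of them lie in `B`. Room for these comes from the removed set `H`, of size `⌊ε
|multi| / 2⌋`: giving up its lightest 1/36 suffices. Trimming all of `H` costs at most `18 ε` times
the two costs together, so this part costs at most `ε / 2`. The remaining increase comes from badly
cut centers and moved clients; it is charged to their counts in `moveBound` and has small mean.

The detours are deterministic once `B ⊆ S*`: a case analysis (`exists_detour_le_budget`) finds, for
every client, a ball in the budget containing both endpoints of its connection, with the quadratic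
term of `b₂` paying for what is left over. Markov's inequality for three quantities (budget, number
of badly cut centers, moving cost), each failing with probability at most 1/9, gives 2/3.

Trimming is possible because at least half of `multi` consists of centers that are not the chosen
nearest one of their fiber; among these the lightest ones are removed. -/

theorem exists_mem_frontier_of_isPreconnected {X : Type*} [TopologicalSpace X] {s C : Set X}
    (hs : IsPreconnected s) {x q : X} (hx : x ∈ s) (hq : q ∈ s) (hxC : x ∈ C) (hqC : q ∉ C) :
    ∃ z ∈ s, z ∈ frontier C := by
  by_contra! h
  have hmem : ∀ y ∈ s, (y ∈ C → y ∈ interior C) ∧ (y ∉ C → y ∈ (closure C)ᶜ) := by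
    intro y hy
    have := h y hy
    rw [frontier, Set.mem_sdiff] at this
    push Not at this
    refine ⟨fun hyC => this (subset_closure hyC), fun hyC hcl => hyC (interior_subset (this hcl))⟩
  obtain ⟨y, _, hy1, hy2⟩ := hs (interior C) (closure C)ᶜ isOpen_interior
    isClosed_closure.isOpen_compl
    (fun y hy => by
      by_cases hyC : y ∈ C
      · exact Or.inl ((hmem y hy).1 hyC)
      · exact Or.inr ((hmem y hy).2 hyC))
    ⟨x, hx, (hmem x hx).1 hxC⟩ ⟨q, hq, (hmem q hq).2 hqC⟩
  exact hy2 (subset_closure (interior_subset hy1))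

theorem mem_frontier_box {d : ℕ} {a b : Fin d → ℝ} (hab : ∀ j, a j < b j) (y : Pt d) :
    y ∈ frontier {z : Pt d | ∀ j, a j ≤ z j ∧ z j < b j} ↔
      (∀ j, a j ≤ y j ∧ y j ≤ b j) ∧ ∃ j, y j = a j ∨ y j = b j := by
  have hset : {z : Pt d | ∀ j, a j ≤ z j ∧ z j < b j} =
      (EuclideanSpace.equiv (Fin d) ℝ).toHomeomorph ⁻¹'
        (Set.univ.pi fun j => Set.Ico (a j) (b j)) := by
    ext z
    simp [Set.mem_pi]
  rw [hset, ← Homeomorph.preimage_frontier, Set.mem_preimage, frontier, closure_pi_set,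
    interior_pi_set Set.finite_univ]
  simp only [closure_Ico (hab _).ne, interior_Ico, Set.mem_sdiff, Set.mem_pi, Set.mem_univ,
    true_implies, Set.mem_Icc, Set.mem_Ioo]
  change ((∀ j, a j ≤ y j ∧ y j ≤ b j) ∧ ¬ ∀ j, a j < y j ∧ y j < b j) ↔ _
  refine and_congr_right fun h => ?_
  push Not
  refine exists_congr fun j => ⟨fun hj => ?_, ?_⟩
  · rcases (h j).1.eq_or_lt with h1 | h1
    · exact Or.inl h1.symm
    · exact Or.inr (le_antisymm (h j).2 (hj h1))
  · rintro (hj | hj) h1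
    · exact absurd hj h1.ne'
    · exact hj.ge

theorem side_pos {d : ℕ} (hd : 0 < d) (i : ℤ) : 0 < side d i := by
  unfold side
  have : (0 : ℝ) < d := by exact_mod_cast hd
  positivity

theorem cell_eq_box {d : ℕ} (hd : 0 < d) {bot top i : ℤ} (hi : i < top) (u : Fin d → ℝ) (x : Pt d) :
    (quadtree d bot top u).cell i x = {z : Pt d | ∀ j,
      origin d top u j + side d i * cubeIndex top u i x j ≤ z j ∧
      z j < origin d top u j + side d i * (cubeIndex top u i x j + 1)} := by
  ext z
  have hs := side_pos hd i
  change (if i < top then Setoid.ker (cubeIndex top u i) else ⊤ : Setoid (Pt d)) z x ↔ _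
  rw [if_pos hi]
  change cubeIndex top u i z = cubeIndex top u i x ↔ _
  rw [funext_iff]
  refine forall_congr' fun j => ?_
  change ⌊(z j - origin d top u j) / side d i⌋ = _ ↔ _
  rw [Int.floor_eq_iff, le_div_iff₀ hs, div_lt_iff₀ hs]
  constructor <;> rintro ⟨h1, h2⟩ <;> constructor <;> linarith

theorem cell_subset_succ {d : ℕ} {bot top i : ℤ} (hb : bot ≤ i) (hi : i < top) (u : Fin d → ℝ)
    (x : Pt d) : (quadtree d bot top u).cell i x ⊆ (quadtree d bot top u).cell (i + 1) x :=
  fun _ hz => (quadtree d bot top u).refines i hb hi hz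

/-- Portals in terms of integer coordinates with respect to the portal grid. -/
theorem mem_portals_iff {d : ℕ} (hd : 0 < d) {bot top i : ℤ} (hi : i < top) (u : Fin d → ℝ)
    {ρ : ℝ} (hρ : 0 < ρ) (x y : Pt d) :
    y ∈ portals d bot top u ρ i x ↔
      ∃ w : Fin d → ℤ, (∀ j, y j = origin d top u j + side d i / (⌈1 / ρ⌉₊ : ℝ) * w j) ∧
        (∀ j, ⌈1 / ρ⌉₊ * cubeIndex top u i x j ≤ w j ∧
          w j ≤ ⌈1 / ρ⌉₊ * (cubeIndex top u i x j + 1)) ∧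
        ∃ j, w j = ⌈1 / ρ⌉₊ * cubeIndex top u i x j ∨
          w j = ⌈1 / ρ⌉₊ * (cubeIndex top u i x j + 1) := by
  have hs := side_pos hd i
  set N := ⌈1 / ρ⌉₊
  have hN : (0 : ℝ) < N := by exact_mod_cast Nat.ceil_pos.2 (by positivity)
  have hmesh : 0 < side d i / N := by positivity
  have hside : ∀ c : ℤ, side d i * c = side d i / N * ((N * c : ℤ) : ℝ) := by
    intro c; push_cast; field_simp
  unfold portals
  rw [Set.mem_ofPred_eq, cell_eq_box hd hi, mem_frontier_box (fun j => by nlinarith)]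
  have key : ∀ w : Fin d → ℤ, (∀ j, y j = origin d top u j + side d i / N * w j) → ∀ j,
      ∀ c : ℤ, (origin d top u j + side d i * c ≤ y j ↔ N * c ≤ w j) ∧
        (y j ≤ origin d top u j + side d i * c ↔ w j ≤ N * c) := by
    intro w hw j c
    rw [hw j, hside, add_le_add_iff_left, add_le_add_iff_left, mul_le_mul_iff_right₀ hmesh,
      mul_le_mul_iff_right₀ hmesh, Int.cast_le, Int.cast_le]
    exact ⟨Iff.rfl, Iff.rfl⟩
  have key2 : ∀ w : Fin d → ℤ, (∀ j, y j = origin d top u j + side d i / N * w j) → ∀ j,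
      ∀ c : ℤ, (y j = origin d top u j + side d i * c ↔ w j = N * c) := by
    intro w hw j c
    rw [le_antisymm_iff, (key w hw j c).1, (key w hw j c).2, ← le_antisymm_iff]
  have hc : ∀ c : ℤ, (c : ℝ) + 1 = ((c + 1 : ℤ) : ℝ) := fun c => by push_cast; rfl
  simp only [hc]
  constructor
  · rintro ⟨⟨h1, j, h2⟩, w, hw⟩
    refine ⟨w, hw, fun j => ⟨((key w hw j _).1).1 (h1 j).1, ((key w hw j _).2).1 (h1 j).2⟩, j, ?_⟩
    rcases h2 with h2 | h2
    · exact Or.inl ((key2 w hw j _).1 h2)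
    · exact Or.inr ((key2 w hw j _).1 h2)
  · rintro ⟨w, hw, h1, j, h2⟩
    refine ⟨⟨fun j => ⟨((key w hw j _).1).2 (h1 j).1, ((key w hw j _).2).2 (h1 j).2⟩, j, ?_⟩, w, hw⟩
    rcases h2 with h2 | h2
    · exact Or.inl ((key2 w hw j _).2 h2)
    · exact Or.inr ((key2 w hw j _).2 h2)

/-- Pinning coordinate `j` leaves `d - 1` free coordinates with `N + 1` integers each. -/
theorem card_box_facet {d : ℕ} (N : ℕ) (z : Fin d → ℤ) (j : Fin d) (c : ℤ) :
    (Fintype.piFinset (Function.update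
      (fun l => Finset.Icc ((N : ℤ) * z l) (N * (z l + 1))) j {c})).card = (N + 1) ^ (d - 1) := by
  rw [Fintype.card_piFinset, ← Finset.mul_prod_erase _ _ (Finset.mem_univ j),
    Function.update_self, Finset.card_singleton, one_mul,
    Finset.prod_congr rfl (g := fun _ => N + 1), Finset.prod_const,
    Finset.card_erase_of_mem (Finset.mem_univ j), Finset.card_univ, Fintype.card_fin]
  intro l hl
  rw [Function.update_of_ne (Finset.ne_of_mem_erase hl), Int.card_Icc]
  have : (N : ℤ) * (z l + 1) + 1 - N * z l = N + 1 := by ring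
  rw [this]; omega

theorem portals_finite_ncard_le {d : ℕ} (hd : 0 < d) {bot top i : ℤ} (hi : i < top)
    (u : Fin d → ℝ) {ρ : ℝ} (hρ : 0 < ρ) (x : Pt d) :
    (portals d bot top u ρ i x).Finite ∧
      (portals d bot top u ρ i x).ncard ≤ 2 * d * (⌈1 / ρ⌉₊ + 1) ^ (d - 1) := by
  classical
  set N := ⌈1 / ρ⌉₊ with hNdef
  set z := cubeIndex top u i x
  let facets : Finset (Fin d → ℤ) := Finset.univ.biUnion fun j : Fin d =>
    ({(N : ℤ) * z j, N * (z j + 1)} : Finset ℤ).biUnion fun c => Fintype.piFinset (Function.update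
      (fun l => Finset.Icc ((N : ℤ) * z l) (N * (z l + 1))) j {c})
  let pos : (Fin d → ℤ) → Pt d := fun w =>
    WithLp.toLp 2 fun j => origin d top u j + side d i / (N : ℝ) * w j
  have hsub : portals d bot top u ρ i x ⊆ (facets.image pos : Set (Pt d)) := by
    intro y hy
    obtain ⟨w, hw, hbox, j, hj⟩ := (mem_portals_iff hd hi u hρ x y).1 hy
    rw [Finset.coe_image]
    refine ⟨w, ?_, ?_⟩
    · simp only [facets, Finset.coe_biUnion, Set.mem_iUnion, Finset.mem_coe, Finset.mem_univ]
      refine ⟨j, trivial, w j, Finset.mem_insert.2 (hj.imp_right Finset.mem_singleton.2), ?_⟩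
      rw [Fintype.mem_piFinset]
      intro l
      by_cases hl : l = j
      · subst hl; simp
      · rw [Function.update_of_ne hl, Finset.mem_Icc]
        exact hbox l
    · ext j
      exact (hw j).symm
  refine ⟨(Finset.finite_toSet _).subset hsub, ?_⟩
  calc (portals d bot top u ρ i x).ncard
      ≤ ((facets.image pos : Finset (Pt d)) : Set (Pt d)).ncard :=
        Set.ncard_le_ncard hsub (Finset.finite_toSet _)
    _ = (facets.image pos).card := Set.ncard_coe_finset _
    _ ≤ facets.card := Finset.card_image_le
    _ ≤ ∑ j : Fin d, 2 * (N + 1) ^ (d - 1) := by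
        refine Finset.card_biUnion_le.trans (Finset.sum_le_sum fun j _ => ?_)
        refine Finset.card_biUnion_le.trans ?_
        simp only [card_box_facet, Finset.sum_const, smul_eq_mul]
        exact Nat.mul_le_mul_right _ Finset.card_le_two
    _ = 2 * d * (N + 1) ^ (d - 1) := by
        simp only [Finset.sum_const, Finset.card_univ, Fintype.card_fin, smul_eq_mul]; ring

theorem dist_le_sqrt_mul {d : ℕ} {y z : Pt d} {h : ℝ} (hh : 0 ≤ h) (H : ∀ j, |y j - z j| ≤ h) :
    dist y z ≤ Real.sqrt d * h := by
  rw [EuclideanSpace.dist_eq]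
  calc Real.sqrt (∑ j, dist (y j) (z j) ^ 2) ≤ Real.sqrt (∑ _j : Fin d, h ^ 2) := by
        refine Real.sqrt_le_sqrt (Finset.sum_le_sum fun j _ => ?_)
        rw [Real.dist_eq]
        exact pow_le_pow_left₀ (abs_nonneg _) (H j) 2
    _ = Real.sqrt d * h := by
        rw [Finset.sum_const, Finset.card_univ, Fintype.card_fin, nsmul_eq_mul,
          Real.sqrt_mul (by positivity), Real.sqrt_sq hh]

theorem int_le_round {t : ℝ} {m : ℤ} (h : (m : ℝ) ≤ t) : m ≤ round t := by
  rw [round_eq]; exact Int.le_floor.2 (by linarith)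

theorem round_le_int {t : ℝ} {m : ℤ} (h : t ≤ (m : ℝ)) : round t ≤ m := by
  rw [round_eq]
  exact Int.lt_add_one_iff.1 (Int.floor_lt.2 (by push_cast; linarith))

/-- The segment from `x` to `q` crosses the boundary; round the crossing point coordinatewise to the
portal grid. The bounds of the cell are grid coordinates, so rounding stays in the closed cell, and
the coordinate that lies on a facet does not move. The point moves by at most `ρ 2 ^ i`, paid once
on each leg. -/
theorem exists_portal_detour {d : ℕ} (hd : 0 < d) {bot top i : ℤ} (hi : i < top)
    (u : Fin d → ℝ) {ρ : ℝ} (hρ : 0 < ρ) (x q : Pt d)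
    (hq : q ∉ (quadtree d bot top u).cell i x) :
    ∃ y ∈ portals d bot top u ρ i x, dist x y + dist y q ≤ dist x q + ρ * (2 : ℝ) ^ (i + 1) := by
  have hs := side_pos hd i
  obtain ⟨p, hpseg, hpf⟩ := exists_mem_frontier_of_isPreconnected
    (convex_segment x q).isPreconnected (left_mem_segment ℝ x q) (right_mem_segment ℝ x q)
    (C := (quadtree d bot top u).cell i x) (Setoid.refl' _ x) hq
  rw [cell_eq_box hd hi, mem_frontier_box (fun j => by nlinarith)] at hpf
  obtain ⟨hbox, j₀, hj₀⟩ := hpf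
  set N := ⌈1 / ρ⌉₊ with hNdef
  have hN : (0 : ℝ) < N := by exact_mod_cast Nat.ceil_pos.2 (by positivity)
  have hmesh : 0 < side d i / N := by positivity
  set z := cubeIndex top u i x
  let t : Fin d → ℝ := fun j => (p j - origin d top u j) / (side d i / N)
  have ht : ∀ j, p j = origin d top u j + side d i / N * t j := by
    intro j; simp only [t]; field_simp; ring
  have hside : ∀ c : ℝ, side d i * c = side d i / N * (N * c) := by
    intro c; field_simp
  have hlo : ∀ j, (((N : ℤ) * z j : ℤ) : ℝ) ≤ t j := by
    intro j
    have := (hbox j).1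
    rw [ht j, hside, add_le_add_iff_left, mul_le_mul_iff_right₀ hmesh] at this
    push_cast; exact this
  have hhi : ∀ j, t j ≤ (((N : ℤ) * (z j + 1) : ℤ) : ℝ) := by
    intro j
    have := (hbox j).2
    rw [ht j, hside, add_le_add_iff_left, mul_le_mul_iff_right₀ hmesh] at this
    push_cast; exact this
  let y : Pt d := WithLp.toLp 2 fun j => origin d top u j + side d i / (N : ℝ) * round (t j)
  have hyp : dist p y ≤ ρ * (2 : ℝ) ^ i := by
    have h1 : dist p y ≤ Real.sqrt d * (side d i / N * (1 / 2)) := by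
      refine dist_le_sqrt_mul (by positivity) fun j => ?_
      have : p j - y j = side d i / N * (t j - round (t j)) := by
        rw [ht j]; simp only [y]; ring
      rw [this, abs_mul, abs_of_pos hmesh]
      exact mul_le_mul_of_nonneg_left (abs_sub_round _) hmesh.le
    refine h1.trans ?_
    have hsd : 0 < Real.sqrt d := Real.sqrt_pos.2 (by exact_mod_cast hd)
    have h2 : Real.sqrt d * (side d i / N * (1 / 2)) = (2 : ℝ) ^ i * (1 / N) := by
      unfold side
      rw [zpow_add_one₀ (by norm_num : (2 : ℝ) ≠ 0)]
      field_simp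
    rw [h2, mul_comm ρ]
    refine mul_le_mul_of_nonneg_left ?_ (by positivity)
    rw [div_le_comm₀ hN hρ]
    exact Nat.le_ceil _
  refine ⟨y, ?_, ?_⟩
  · rw [mem_portals_iff hd hi u hρ]
    refine ⟨fun j => round (t j), fun j => rfl, fun j =>
      ⟨int_le_round (hlo j), round_le_int (hhi j)⟩, j₀, ?_⟩
    rcases hj₀ with h | h
    · left
      rw [ht j₀, hside, add_right_inj, mul_right_inj' hmesh.ne'] at h
      have : t j₀ = (((N : ℤ) * z j₀ : ℤ) : ℝ) := by push_cast; exact h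
      exact (congrArg round this).trans (round_intCast _)
    · right
      rw [ht j₀, hside, add_right_inj, mul_right_inj' hmesh.ne'] at h
      have : t j₀ = (((N : ℤ) * (z j₀ + 1) : ℤ) : ℝ) := by push_cast; exact h
      exact (congrArg round this).trans (round_intCast _)
  · have h1 := dist_add_dist_of_mem_segment hpseg
    have h2 := dist_triangle x p y
    have h3 := dist_triangle y p q
    rw [dist_comm y p] at h3
    have h4 : ρ * (2 : ℝ) ^ (i + 1) = 2 * (ρ * (2 : ℝ) ^ i) := by
      rw [zpow_add_one₀ (by norm_num : (2 : ℝ) ≠ 0)]; ring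
    linarith

/-- A boundary point of the larger cell cannot be interior to a smaller cell inside it, and the
coarse grid is the fine one with even coordinates. -/
theorem portals_succ_mem {d : ℕ} {bot top i : ℤ} (hb : bot ≤ i) (hi : i < top)
    (u : Fin d → ℝ) {ρ : ℝ} (x y : Pt d)
    (hy : y ∈ portals d bot top u ρ (i + 1) x)
    (hcl : y ∈ closure ((quadtree d bot top u).cell i x)) :
    y ∈ portals d bot top u ρ i x := by
  obtain ⟨hf, w, hw⟩ := hy
  refine ⟨⟨hcl, fun hint => hf.2 (interior_mono (cell_subset_succ hb hi u x) hint)⟩,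
    fun j => 2 * w j, fun j => ?_⟩
  rw [hw j, side_succ]
  push_cast
  ring

theorem goodPortals {d : ℕ} (hd : 0 < d) (bot top : ℤ) (u : Fin d → ℝ) {ρ : ℝ} (hρ : 0 < ρ)
    (hρ1 : ρ ≤ 1) : GoodPortals d bot top u ρ (2 * d * 3 ^ (d - 1)) := by
  intro i hb hi x
  refine ⟨⟨(portals_finite_ncard_le hd hi u hρ x).1, ?_⟩,
    fun q hq => exists_portal_detour hd hi u hρ x q hq,
    fun y hy hcl => portals_succ_mem hb hi u x y hy hcl⟩
  have h1 : ((portals d bot top u ρ i x).ncard : ℝ) ≤ 2 * d * ((⌈1 / ρ⌉₊ : ℝ) + 1) ^ (d - 1) := by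
    exact_mod_cast (portals_finite_ncard_le hd hi u hρ x).2
  refine h1.trans ?_
  have h2 : (⌈1 / ρ⌉₊ : ℝ) + 1 ≤ 3 / ρ := by
    have h3 := Nat.ceil_lt_add_one (a := 1 / ρ) (by positivity)
    have h4 : 1 ≤ 1 / ρ := by rw [le_div_iff₀ hρ]; linarith
    have h5 : 3 / ρ = 3 * (1 / ρ) := by ring
    linarith
  calc 2 * d * ((⌈1 / ρ⌉₊ : ℝ) + 1) ^ (d - 1) ≤ 2 * d * (3 / ρ) ^ (d - 1) := by gcongr
    _ = 2 * d * 3 ^ (d - 1) / ρ ^ (d - 1) := by rw [div_pow]; ring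

/-! ### Levels of a hierarchical decomposition -/

theorem HierDecomp.level_mono {X : Type*} (D : HierDecomp X) {S T : Set X} (h : S ⊆ T) :
    D.level S ≤ D.level T := by
  classical
  refine Finset.max_mono fun i hi => ?_
  rw [Finset.mem_filter] at hi ⊢
  obtain ⟨h1, x, hx, y, hy, hxy⟩ := hi
  exact ⟨h1, x, h hx, y, h hy, hxy⟩

theorem HierDecomp.separates_of_level_eq {X : Type*} (D : HierDecomp X) {T : Set X} {i : ℤ}
    (h : D.level T = i) : D.bot ≤ i ∧ i ≤ D.top ∧ D.Separates i T := by
  classical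
  have := Finset.mem_of_max h
  rw [Finset.mem_filter, Finset.mem_Icc] at this
  exact ⟨this.1.1, this.1.2, this.2⟩

theorem HierDecomp.level_singleton {X : Type*} (D : HierDecomp X) (x : X) :
    D.level {x, x} = ⊥ := by
  classical
  unfold HierDecomp.level
  rw [Finset.max_eq_bot, Finset.filter_eq_empty_iff]
  rintro i _ ⟨y, hy, z, hz, hyz⟩
  simp only [Set.mem_insert_iff, Set.mem_singleton_iff, or_self] at hy hz
  subst hy; subst hz
  exact hyz (Setoid.refl' _ _)

@[simp] theorem pow2_bot : pow2 ⊥ = 0 := rfl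

@[simp] theorem pow2_coe (i : ℤ) : pow2 (i : WithBot ℤ) = (2 : ℝ) ^ i := rfl

theorem pow2_nonneg (l : WithBot ℤ) : 0 ≤ pow2 l := by
  induction l using WithBot.recBotCoe with
  | bot => simp
  | coe i => rw [pow2_coe]; positivity

theorem pow2_mono {l l' : WithBot ℤ} (h : l ≤ l') : pow2 l ≤ pow2 l' := by
  induction l using WithBot.recBotCoe with
  | bot => simpa using pow2_nonneg l'
  | coe i =>
    induction l' using WithBot.recBotCoe with
    | bot => simp at h
    | coe j =>
      rw [pow2_coe, pow2_coe]
      exact zpow_le_zpow_right₀ (by norm_num) (by exact_mod_cast h)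

/-! ### Cuts of a ball -/

/-- The number of hyperplanes of the level-`i` grid that meet the ball `B(x, r)`; it is set to zero
from level `top` on. -/
noncomputable def cutCount (d : ℕ) (top : ℤ) (x : Pt d) (r : ℝ) (i : ℤ) (u : Fin d → ℝ) : ℝ :=
  if i < top then ∑ j, ((⌊(x j + r - origin d top u j) / side d i⌋ : ℝ) -
    ⌊(x j - r - origin d top u j) / side d i⌋) else 0

theorem floor_le_floor_of_coord {d : ℕ} (hd : 0 < d) (i : ℤ) {a b o : ℝ} (hab : a ≤ b) :
    ⌊(a - o) / side d i⌋ ≤ ⌊(b - o) / side d i⌋ := by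
  have := side_pos hd i
  exact Int.floor_le_floor (by gcongr)

theorem cutCount_nonneg {d : ℕ} (hd : 0 < d) (top : ℤ) (x : Pt d) {r : ℝ} (hr : 0 ≤ r) (i : ℤ)
    (u : Fin d → ℝ) : 0 ≤ cutCount d top x r i u := by
  unfold cutCount
  split_ifs
  · refine Finset.sum_nonneg fun j _ => sub_nonneg.2 ?_
    exact_mod_cast floor_le_floor_of_coord hd i (by linarith : x j - r ≤ x j + r)
  · exact le_rfl

theorem side_add (d : ℕ) (i : ℤ) (n : ℕ) : side d (i + n) = side d i * 2 ^ n := by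
  induction n with
  | zero => simp
  | succ n ih =>
    push_cast
    rw [← add_assoc, side_succ, ih, pow_succ]
    ring

/-- All grids share one corner and have dyadic ratios, so the coarse index is the integer quotient
of the fine one by `2 ^ n`. -/
theorem cubeIndex_eq_of_le {d : ℕ} {top : ℤ} {u : Fin d → ℝ} {i i' : ℤ} (hi : i ≤ i') {y z : Pt d}
    (h : cubeIndex top u i y = cubeIndex top u i z) :
    cubeIndex top u i' y = cubeIndex top u i' z := by
  obtain ⟨n, rfl⟩ := Int.le.dest hi
  funext j
  have hj := congrFun h j
  unfold cubeIndex at hj ⊢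
  have key : ∀ a : ℝ, ⌊a / 2 ^ n⌋ = ⌊a⌋ / 2 ^ n := fun a => by
    have := Int.floor_div_natCast a (2 ^ n)
    simpa using this
  rw [side_add, ← div_div, ← div_div, key, key, hj]

/-- Points separated at level `l` are separated by every finer grid. The level `i` may lie below
`bot`, since `cutCount` refers to the grids only. -/
theorem one_le_cutCount {d : ℕ} (hd : 0 < d) {bot top : ℤ} {u : Fin d → ℝ} {x : Pt d} {r : ℝ}
    {i l : ℤ} (hl : ballLevel (quadtree d bot top u) x r = l) (hil : i ≤ l) :
    1 ≤ cutCount d top x r i u := by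
  obtain ⟨-, hlt, y, hy, z, hz, hyz⟩ := HierDecomp.separates_of_level_eq _ hl
  change l ≤ top at hlt
  change ¬ (if l < top then Setoid.ker (cubeIndex top u l) else ⊤ : Setoid (Pt d)) y z at hyz
  have hlt' : l < top := by
    by_contra hlt'
    rw [if_neg hlt'] at hyz
    exact hyz trivial
  rw [if_pos hlt'] at hyz
  have hne : cubeIndex top u i y ≠ cubeIndex top u i z := fun h => hyz (cubeIndex_eq_of_le hil h)
  obtain ⟨j, hj⟩ := Function.ne_iff.1 hne
  have hcoord : ∀ w ∈ Metric.closedBall x r, x j - r ≤ w j ∧ w j ≤ x j + r := by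
    intro w hw
    have h1 : ‖w j - x j‖ ≤ r :=
      (PiLp.norm_apply_le (p := 2) (w - x) j).trans (by simpa [dist_eq_norm] using hw)
    rw [Real.norm_eq_abs, abs_le] at h1
    constructor <;> linarith
  have hr : 0 ≤ r := dist_nonneg.trans (Metric.mem_closedBall.1 hy)
  unfold cutCount
  rw [if_pos (hil.trans_lt hlt')]
  have hterm : ∀ l : Fin d, (0 : ℝ) ≤ (⌊(x l + r - origin d top u l) / side d i⌋ : ℝ) -
      ⌊(x l - r - origin d top u l) / side d i⌋ := fun l => sub_nonneg.2 (by
    exact_mod_cast floor_le_floor_of_coord hd i (by linarith : x l - r ≤ x l + r))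
  refine le_trans ?_ (Finset.single_le_sum (fun l _ => hterm l) (Finset.mem_univ j))
  have h1 := floor_le_floor_of_coord hd i (o := origin d top u j) (hcoord y hy).1
  have h2 := floor_le_floor_of_coord hd i (o := origin d top u j) (hcoord y hy).2
  have h3 := floor_le_floor_of_coord hd i (o := origin d top u j) (hcoord z hz).1
  have h4 := floor_le_floor_of_coord hd i (o := origin d top u j) (hcoord z hz).2
  change ⌊(y j - origin d top u j) / side d i⌋ ≠ ⌊(z j - origin d top u j) / side d i⌋ at hj
  have h5 : 1 ≤ ⌊(x j + r - origin d top u j) / side d i⌋ -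
      ⌊(x j - r - origin d top u j) / side d i⌋ := by omega
  exact_mod_cast h5

/-! ### Expected number of cuts -/

instance : IsProbabilityMeasure (volume.restrict (Set.Ico (0 : ℝ) 1)) :=
  ⟨by simp⟩

instance (d : ℕ) : IsProbabilityMeasure (shiftLaw d) := by
  unfold shiftLaw; infer_instance

theorem integrable_floor_affine (A B : ℝ) :
    Integrable (fun t : ℝ => (⌊A - B * t⌋ : ℝ)) (volume.restrict (Set.Ico (0 : ℝ) 1)) := by
  have hm : Measurable (fun t : ℝ => (⌊A - B * t⌋ : ℝ)) := by fun_prop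
  refine Integrable.of_bound (C := |A| + |B| + 1) hm.aestronglyMeasurable ?_
  filter_upwards [ae_restrict_mem measurableSet_Ico] with t ht
  rw [Real.norm_eq_abs, abs_le]
  have h1 : |B * t| ≤ |B| := by
    rw [abs_mul, abs_of_nonneg ht.1]
    exact mul_le_of_le_one_right (abs_nonneg _) ht.2.le
  have h2 := abs_le.1 h1
  have h3 := abs_le.1 (le_refl |A|)
  have h4 := Int.floor_le (A - B * t)
  have h5 := Int.lt_floor_add_one (A - B * t)
  constructor <;> linarith [h2.1, h2.2, h3.1, h3.2]

/-- Write the floor as the identity minus the fractional part. As `N` is a positive integer, `t ↦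
fract (E - N t)` runs through whole periods on `[0, 1)`, so its integral does not depend on `E` and
the two fractional parts cancel. -/
theorem integral_floor_sub_floor (A B : ℝ) {N : ℕ} (hN : 0 < N) :
    ∫ t in Set.Ico (0 : ℝ) 1, ((⌊B - N * t⌋ : ℝ) - ⌊A - N * t⌋) = B - A := by
  have hN' : (N : ℝ) ≠ 0 := by positivity
  have hfr : ∀ E : ℝ, Integrable (fun t : ℝ => Int.fract (E - N * t))
      (volume.restrict (Set.Ico (0 : ℝ) 1)) := by
    intro E
    have h1 : Integrable (fun t : ℝ => E - N * t) (volume.restrict (Set.Ico (0 : ℝ) 1)) := by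
      refine Integrable.mono_measure ?_ (Measure.restrict_mono Set.Ico_subset_Icc_self le_rfl)
      exact (by fun_prop : Continuous fun t : ℝ => E - N * t).integrableOn_Icc
    exact h1.sub (integrable_floor_affine E N)
  have hper : ∀ E : ℝ, ∫ t in Set.Ico (0 : ℝ) 1, Int.fract (E - N * t) =
      (N : ℝ)⁻¹ * ∫ t in (0 : ℝ)..0 + N, Int.fract t := by
    intro E
    rw [integral_Ico_eq_integral_Ioc, ← intervalIntegral.integral_of_le zero_le_one,
      intervalIntegral.integral_comp_sub_mul (fun t => Int.fract t) hN' E, smul_eq_mul]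
    congr 1
    have hp : Function.Periodic (Int.fract : ℝ → ℝ) (N : ℝ) := fun t => Int.fract_add_natCast t N
    rw [← hp.intervalIntegral_add_eq (E - N * 1) 0]
    congr 1
    ring
  have hsplit : ∀ t : ℝ, ((⌊B - N * t⌋ : ℝ) - ⌊A - N * t⌋) =
      (B - A) - (Int.fract (B - N * t) - Int.fract (A - N * t)) := by
    intro t
    have h1 := Int.floor_add_fract (B - N * t)
    have h2 := Int.floor_add_fract (A - N * t)
    linarith
  simp_rw [hsplit]
  rw [integral_sub (integrable_const _) (by exact (hfr B).sub (hfr A)),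
    integral_sub (hfr B) (hfr A),
    hper, hper]
  simp

theorem integrable_integral_floor_coord {d : ℕ} (A B : ℝ) {N : ℕ} (hN : 0 < N) (j : Fin d) :
    Integrable (fun u : Fin d → ℝ => ((⌊B - N * u j⌋ : ℝ) - ⌊A - N * u j⌋)) (shiftLaw d) ∧
    ∫ u, ((⌊B - N * u j⌋ : ℝ) - ⌊A - N * u j⌋) ∂(shiftLaw d) = B - A := by
  have hmp := measurePreserving_eval (fun _ : Fin d => volume.restrict (Set.Ico (0 : ℝ) 1)) j
  have hint : Integrable (fun t : ℝ => ((⌊B - N * t⌋ : ℝ) - ⌊A - N * t⌋))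
      (volume.restrict (Set.Ico (0 : ℝ) 1)) :=
    (integrable_floor_affine B N).sub (integrable_floor_affine A N)
  refine ⟨hmp.integrable_comp_of_integrable hint, ?_⟩
  rw [← integral_floor_sub_floor A B hN, ← hmp.map_eq,
    integral_map hmp.aemeasurable (by rw [hmp.map_eq]; exact hint.aestronglyMeasurable)]
  rfl

theorem cutCount_integrable_and_integral_le {d : ℕ} (hd : 0 < d) (top : ℤ) (x : Pt d) {r : ℝ}
    (hr : 0 ≤ r) (i : ℤ) :
    Integrable (cutCount d top x r i) (shiftLaw d) ∧
    ∫ u, cutCount d top x r i u ∂(shiftLaw d) ≤ d * Real.sqrt d * r / (2 : ℝ) ^ i := by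
  unfold cutCount
  split_ifs with hi
  swap
  · exact ⟨integrable_zero _ _ _, by simp; positivity⟩
  obtain ⟨n, hn⟩ := Int.le.dest hi.le
  have hs := side_pos hd i
  -- In units of the level-`i` mesh the shift is `2 ^ n u`, with `2 ^ n` the ratio of the root side
  -- to the side of level `i`: an integer, as the averaging over whole periods requires.
  have hrw : ∀ (b : ℝ) (u : Fin d → ℝ) (j : Fin d), (b - origin d top u j) / side d i =
      b / side d i - ((2 ^ n : ℕ) : ℝ) * u j := by
    intro b u j
    unfold origin
    rw [← hn, side_add, Nat.cast_pow, Nat.cast_ofNat]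
    field_simp
  simp_rw [hrw]
  have key := fun j : Fin d => integrable_integral_floor_coord ((x j - r) / side d i)
    ((x j + r) / side d i) (N := 2 ^ n) (by positivity) j
  refine ⟨integrable_finsetSum _ fun j _ => (key j).1, ?_⟩
  rw [integral_finsetSum _ fun j _ => (key j).1, Finset.sum_congr rfl fun j _ => (key j).2]
  refine le_of_eq ?_
  have hterm : ∀ j : Fin d, (x j + r) / side d i - (x j - r) / side d i =
      Real.sqrt d * r / (2 : ℝ) ^ i := by
    intro j
    have hsd : 0 < Real.sqrt d := Real.sqrt_pos.2 (by exact_mod_cast hd)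
    rw [← sub_div]
    unfold side
    rw [zpow_add_one₀ (by norm_num : (2 : ℝ) ≠ 0)]
    field_simp
    ring
  rw [Finset.sum_congr rfl fun j _ => hterm j]
  simp only [Finset.sum_const, Finset.card_univ, Fintype.card_fin, nsmul_eq_mul]
  ring

/-! ### Detours of balls -/

/-- Turns the logarithmic threshold into a linear one: it compares `δ 2 ^ level` with `d r`. -/
theorem rpow_logb_add_tau {d : ℕ} (hd : 0 < d) {δ r : ℝ} (hδ : 0 < δ) (hr : 0 < r) :
    (2 : ℝ) ^ (Real.logb 2 r + tau δ d) = r * d / δ := by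
  have hd' : (0 : ℝ) < d := by exact_mod_cast hd
  unfold tau
  rw [Real.rpow_add two_pos, Real.rpow_add two_pos, Real.rpow_logb two_pos (by norm_num) hr,
    Real.rpow_logb two_pos (by norm_num) hd', Real.rpow_logb two_pos (by norm_num) (by positivity)]
  ring

/-- Ensures that `Real.logb 2 r` is a genuine logarithm whenever the ball is cut. -/
theorem radius_pos_of_ballLevel_eq {d : ℕ} {bot top : ℤ} {u : Fin d → ℝ} {x : Pt d} {r : ℝ} {l : ℤ}
    (hl : ballLevel (quadtree d bot top u) x r = l) : 0 < r := by
  obtain ⟨-, -, y, hy, z, hz, hyz⟩ := HierDecomp.separates_of_level_eq _ hl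
  by_contra! hr
  have hy' : y = x := dist_le_zero.1 (hy.trans hr)
  have hz' : z = x := dist_le_zero.1 (hz.trans hr)
  rw [hy', hz'] at hyz
  exact hyz (Setoid.refl' _ _)

theorem ballLevel_eq_bot_or {d : ℕ} (D : HierDecomp (Pt d)) (x : Pt d) (r : ℝ) :
    ballLevel D x r = ⊥ ∨ ∃ l : ℤ, ballLevel D x r = l := by
  induction ballLevel D x r using WithBot.recBotCoe with
  | bot => exact Or.inl rfl
  | coe l => exact Or.inr ⟨l, rfl⟩

theorem LevelLe.mul_pow2_le {d : ℕ} (hd : 0 < d) {bot top : ℤ} {u : Fin d → ℝ} {x : Pt d}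
    {r δ : ℝ} (hδ : 0 < δ) (hr : 0 ≤ r) (h : LevelLe (quadtree d bot top u) δ x r) :
    δ * pow2 (ballLevel (quadtree d bot top u) x r) ≤ d * r := by
  rcases ballLevel_eq_bot_or (quadtree d bot top u) x r with hl | ⟨l, hl⟩
  · rw [hl, pow2_bot, mul_zero]; positivity
  · have h1 := h l hl
    rw [hl, pow2_coe]
    have h2 := Real.rpow_le_rpow_of_exponent_le (by norm_num : (1 : ℝ) ≤ 2) h1
    rw [rpow_logb_add_tau hd hδ (radius_pos_of_ballLevel_eq hl), Real.rpow_intCast,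
      le_div_iff₀ hδ] at h2
    linarith

theorem BadlyCut.le_mul_pow2 {d : ℕ} (hd : 0 < d) {bot top : ℤ} {u : Fin d → ℝ} {x : Pt d}
    {r δ : ℝ} (hδ : 0 < δ) (h : BadlyCut (quadtree d bot top u) δ x r) :
    d * r ≤ δ * pow2 (ballLevel (quadtree d bot top u) x r) := by
  obtain ⟨l, hl, h1⟩ := h
  rw [hl, pow2_coe]
  have h2 := Real.rpow_le_rpow_of_exponent_le (by norm_num : (1 : ℝ) ≤ 2) h1
  rw [rpow_logb_add_tau hd hδ (radius_pos_of_ballLevel_eq hl), Real.rpow_intCast,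
    div_le_iff₀ hδ] at h2
  linarith

theorem levelLe_of_not_badlyCut {d : ℕ} {D : HierDecomp (Pt d)} {δ r : ℝ} {x : Pt d}
    (h : ¬ BadlyCut D δ x r) : LevelLe D δ x r := by
  intro i hi
  by_contra! hlt
  exact h ⟨i, hi, hlt.le⟩

theorem badlyCut_of_not_levelLe {d : ℕ} {D : HierDecomp (Pt d)} {δ r : ℝ} {x : Pt d}
    (h : ¬ LevelLe D δ x r) : BadlyCut D δ x r := by
  by_contra hb
  exact h (levelLe_of_not_badlyCut hb)

/-- An upper bound for the indicator of `B(x, r)` being badly cut. -/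
noncomputable def badCount (d : ℕ) (top : ℤ) (δ : ℝ) (x : Pt d) (r : ℝ) (u : Fin d → ℝ) : ℝ :=
  cutCount d top x r ⌈Real.logb 2 r + tau δ d⌉ u

theorem badCount_nonneg {d : ℕ} (hd : 0 < d) (top : ℤ) (δ : ℝ) (x : Pt d) {r : ℝ} (hr : 0 ≤ r)
    (u : Fin d → ℝ) : 0 ≤ badCount d top δ x r u := cutCount_nonneg hd _ _ hr _ _

theorem one_le_badCount {d : ℕ} (hd : 0 < d) {bot top : ℤ} {u : Fin d → ℝ} {x : Pt d} {r δ : ℝ}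
    (h : BadlyCut (quadtree d bot top u) δ x r) : 1 ≤ badCount d top δ x r u := by
  obtain ⟨l, hl, h1⟩ := h
  exact one_le_cutCount hd hl (Int.ceil_le.2 h1)

theorem integrable_badCount {d : ℕ} (hd : 0 < d) (top : ℤ) (δ : ℝ) (x : Pt d) {r : ℝ}
    (hr : 0 ≤ r) : Integrable (badCount d top δ x r) (shiftLaw d) :=
  (cutCount_integrable_and_integral_le hd top x hr _).1

/-- The counted level satisfies `2 ^ i ≥ r d / δ`, so the mean number of cuts `d √d r / 2 ^ i` loses
its dependence on `r`. -/
theorem integral_badCount_le {d : ℕ} (hd : 0 < d) (top : ℤ) {δ : ℝ} (hδ : 0 < δ) (x : Pt d) {r : ℝ}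
    (hr : 0 ≤ r) : ∫ u, badCount d top δ x r u ∂(shiftLaw d) ≤ Real.sqrt d * δ := by
  refine (cutCount_integrable_and_integral_le hd top x hr _).2.trans ?_
  rcases hr.eq_or_lt with rfl | hr
  · simp; positivity
  have hd' : (0 : ℝ) < d := by exact_mod_cast hd
  have h1 : r * d / δ ≤ (2 : ℝ) ^ ⌈Real.logb 2 r + tau δ d⌉ := by
    rw [← rpow_logb_add_tau hd hδ hr, ← Real.rpow_intCast]
    exact Real.rpow_le_rpow_of_exponent_le (by norm_num) (Int.le_ceil _)
  rw [div_le_iff₀ (by positivity)]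
  calc d * Real.sqrt d * r = Real.sqrt d * δ * (r * d / δ) := by field_simp
    _ ≤ _ := by gcongr

/-- An upper bound for `2 ^ level(x, r)` when the ball is not badly cut. -/
noncomputable def levelBound (d : ℕ) (top : ℤ) (δ : ℝ) (x : Pt d) (r : ℝ) (u : Fin d → ℝ) : ℝ :=
  r + ∑ n ∈ Finset.range (⌊tau δ d⌋₊ + 1),
    (2 : ℝ) ^ (⌈Real.logb 2 r⌉ + n) * cutCount d top x r (⌈Real.logb 2 r⌉ + n) u

theorem levelBound_nonneg {d : ℕ} (hd : 0 < d) (top : ℤ) (δ : ℝ) (x : Pt d) {r : ℝ} (hr : 0 ≤ r)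
    (u : Fin d → ℝ) : 0 ≤ levelBound d top δ x r u :=
  add_nonneg hr (Finset.sum_nonneg fun n _ =>
    mul_nonneg (by positivity) (cutCount_nonneg hd _ _ hr _ _))

/-- A level below `⌈log r⌉` gives `2 ^ level ≤ r`. Otherwise the level is `⌈log r⌉ + n` with `n ≤
τ`, and the corresponding summand alone is large enough because the grid of that level meets the
ball. -/
theorem LevelLe.pow2_le_levelBound {d : ℕ} (hd : 0 < d) {bot top : ℤ} {u : Fin d → ℝ} {x : Pt d}
    {r δ : ℝ} (hr : 0 ≤ r) (h : LevelLe (quadtree d bot top u) δ x r) :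
    pow2 (ballLevel (quadtree d bot top u) x r) ≤ levelBound d top δ x r u := by
  rcases ballLevel_eq_bot_or (quadtree d bot top u) x r with hl | ⟨l, hl⟩
  · rw [hl, pow2_bot]; exact levelBound_nonneg hd _ _ _ hr _
  have hr0 := radius_pos_of_ballLevel_eq hl
  rw [hl, pow2_coe]
  unfold levelBound
  set m := ⌈Real.logb 2 r⌉ with hm
  have hterm : ∀ n : ℕ, 0 ≤ (2 : ℝ) ^ (m + n) * cutCount d top x r (m + n) u := fun n =>
    mul_nonneg (by positivity) (cutCount_nonneg hd _ _ hr _ _)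
  rcases lt_or_ge l m with hlm | hlm
  · have h1 : (l : ℝ) ≤ Real.logb 2 r := (Int.lt_ceil.1 hlm).le
    have h2 := Real.rpow_le_rpow_of_exponent_le (by norm_num : (1 : ℝ) ≤ 2) h1
    rw [Real.rpow_intCast, Real.rpow_logb two_pos (by norm_num) hr0] at h2
    exact h2.trans (le_add_of_nonneg_right (Finset.sum_nonneg fun n _ => hterm n))
  · obtain ⟨n, hn⟩ := Int.le.dest hlm
    have h1 := h l hl
    have h2 : n < ⌊tau δ d⌋₊ + 1 := by
      refine Nat.lt_succ_of_le (Nat.le_floor ?_)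
      have h3 := Int.le_ceil (Real.logb 2 r)
      rw [← hn, ← hm] at *
      push_cast at h1
      linarith
    have h3 := one_le_cutCount hd hl (le_of_eq hn)
    calc (2 : ℝ) ^ l ≤ (2 : ℝ) ^ (m + n) * cutCount d top x r (m + n) u := by
          rw [← hn]; exact le_mul_of_one_le_right (by positivity) h3
      _ ≤ _ := Finset.single_le_sum (f := fun n : ℕ => (2 : ℝ) ^ (m + n) *
          cutCount d top x r (m + n) u) (fun n _ => hterm n) (Finset.mem_range.2 h2)
      _ ≤ _ := le_add_of_nonneg_left hr

theorem integrable_levelBound {d : ℕ} (hd : 0 < d) (top : ℤ) (δ : ℝ) (x : Pt d) {r : ℝ}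
    (hr : 0 ≤ r) : Integrable (levelBound d top δ x r) (shiftLaw d) :=
  (integrable_const r).add (integrable_finsetSum _ fun _ _ =>
    (cutCount_integrable_and_integral_le hd top x hr _).1.const_mul _)

/-- The weight `2 ^ i` cancels the decay of the mean number of cuts, so every level contributes at
most `d √d r`; there are at most `1 + τ` of them. -/
theorem integral_levelBound_le {d : ℕ} (hd : 0 < d) (top : ℤ) {δ : ℝ} (hτ : 0 ≤ tau δ d) (x : Pt d)
    {r : ℝ} (hr : 0 ≤ r) : ∫ u, levelBound d top δ x r u ∂(shiftLaw d) ≤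
      2 * d * Real.sqrt d * (1 + tau δ d) * r := by
  have hcut := fun i => cutCount_integrable_and_integral_le hd top x hr i
  unfold levelBound
  rw [integral_add (integrable_const r) (integrable_finsetSum _ fun n _ =>
    (hcut _).1.const_mul _), integral_finsetSum _ fun n _ => (hcut _).1.const_mul _]
  have hd1 : (1 : ℝ) ≤ d := by exact_mod_cast hd
  have hsd : 1 ≤ Real.sqrt d := Real.one_le_sqrt.2 hd1
  have hds : 1 ≤ d * Real.sqrt d := by nlinarith
  have h1 : ∀ n ∈ Finset.range (⌊tau δ d⌋₊ + 1),
      ∫ u, (2 : ℝ) ^ (⌈Real.logb 2 r⌉ + n) * cutCount d top x r (⌈Real.logb 2 r⌉ + n) u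
        ∂(shiftLaw d) ≤ d * Real.sqrt d * r := by
    intro n _
    rw [integral_const_mul]
    refine (mul_le_mul_of_nonneg_left (hcut _).2 (by positivity)).trans (le_of_eq ?_)
    field_simp
  have h2 := Finset.sum_le_sum h1
  rw [Finset.sum_const, Finset.card_range, nsmul_eq_mul] at h2
  have h3 : ((⌊tau δ d⌋₊ + 1 : ℕ) : ℝ) ≤ 1 + tau δ d := by
    push_cast; linarith [Nat.floor_le hτ]
  have h4 : ((⌊tau δ d⌋₊ + 1 : ℕ) : ℝ) * (d * Real.sqrt d * r) ≤
      (1 + tau δ d) * (d * Real.sqrt d * r) := by gcongr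
  have h5 : r ≤ (1 + tau δ d) * (d * Real.sqrt d * r) := by
    have : 1 * (1 * r) ≤ (1 + tau δ d) * (d * Real.sqrt d * r) := by gcongr; linarith
    linarith
  simp only [integral_const, probReal_univ, one_smul] at *
  linarith

theorem det_nonneg {d : ℕ} (D : HierDecomp (Pt d)) {δ r : ℝ} (hδ : 0 < δ) (x : Pt d) (hr : 0 ≤ r) :
    0 ≤ det D δ x r := by
  have := pow2_nonneg (ballLevel D x r)
  unfold det
  positivity

/-- Without a bad cut `δ 2 ^ level ≤ d r`, so one factor of the quadratic term is absorbed and the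
detour is linear in `2 ^ level`. -/
theorem LevelLe.det_le {d : ℕ} (hd : 0 < d) {bot top : ℤ} {u : Fin d → ℝ} {x : Pt d}
    {r δ : ℝ} (hδ : 0 < δ) (hr : 0 ≤ r) (h : LevelLe (quadtree d bot top u) δ x r) :
    det (quadtree d bot top u) δ x r ≤ δ * (1 + d) * r * levelBound d top δ x r u := by
  have h1 := h.mul_pow2_le hd hδ hr
  have h2 := h.pow2_le_levelBound hd hr
  unfold det
  set L := pow2 (ballLevel (quadtree d bot top u) x r)
  have hL : 0 ≤ L := pow2_nonneg _
  calc δ * L * r + δ ^ 2 * L ^ 2 = δ * L * r + (δ * L) * (δ * L) := by ring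
    _ ≤ δ * L * r + (d * r) * (δ * L) := by gcongr
    _ = δ * (1 + d) * r * L := by ring
    _ ≤ _ := by gcongr

/-! ### Distances to finite sets of centers -/

theorem distTo_nonneg {d : ℕ} (S : Finset (Pt d)) (x : Pt d) : 0 ≤ distTo S x :=
  Metric.infDist_nonneg

theorem distTo_le {d : ℕ} {S : Finset (Pt d)} {f : Pt d} (hf : f ∈ S) (x : Pt d) :
    distTo S x ≤ dist x f := Metric.infDist_le_dist_of_mem (by exact_mod_cast hf)

theorem distTo_anti {d : ℕ} {S T : Finset (Pt d)} (hS : S.Nonempty) (h : S ⊆ T) (x : Pt d) :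
    distTo T x ≤ distTo S x :=
  Metric.infDist_le_infDist_of_subset (by exact_mod_cast h) (by exact_mod_cast hS)

theorem distTo_le_add {d : ℕ} (S : Finset (Pt d)) (x y : Pt d) :
    distTo S x ≤ distTo S y + dist x y := Metric.infDist_le_infDist_add_dist

theorem exists_isNearestMap {d : ℕ} {S : Finset (Pt d)} (hS : S.Nonempty) :
    ∃ β : Pt d → Pt d, IsNearestMap S β := by
  choose β hβ using fun x : Pt d => S.exists_min_image (fun a => dist x a) hS
  exact ⟨β, hβ⟩

theorem IsNearestMap.distTo_eq {d : ℕ} {S : Finset (Pt d)} {β : Pt d → Pt d}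
    (hβ : IsNearestMap S β) (x : Pt d) : distTo S x = dist x (β x) := by
  refine le_antisymm (distTo_le (hβ x).1 x) ?_
  have hne : ((S : Set (Pt d))).Nonempty := ⟨β x, (hβ x).1⟩
  exact (Metric.le_infDist hne).2 fun y hy => (hβ x).2 y hy

theorem distTo_eq_zero {d : ℕ} {S : Finset (Pt d)} {x : Pt d} (hx : x ∈ S) : distTo S x = 0 :=
  le_antisymm ((distTo_le hx x).trans (dist_self x).le) (distTo_nonneg S x)

/-- The center of `A` closest to a center `f` is not much further from `x` than `f`. -/
theorem IsNearestMap.dist_map_le {d : ℕ} {A : Finset (Pt d)} {α : Pt d → Pt d}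
    (hα : IsNearestMap A α) (x f : Pt d) : dist x (α f) ≤ 2 * dist x f + distTo A x := by
  have h1 := dist_triangle x f (α f)
  have h2 := (hα f).2 (α x) (hα x).1
  have h3 := dist_triangle f x (α x)
  rw [dist_comm f x] at h3
  rw [hα.distTo_eq x]
  linarith

/-! ### Averaging -/

/-- Deleting a heaviest element does not increase the average; delete until `n` elements are left.
-/
theorem exists_subset_card_sum_mul_le {ι : Type*} [DecidableEq ι] (s : Finset ι) (w : ι → ℝ) {n : ℕ}
    (hn : n ≤ s.card) :
    ∃ t ⊆ s, t.card = n ∧ (∑ i ∈ t, w i) * s.card ≤ n * ∑ i ∈ s, w i := by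
  induction hn using Nat.decreasingInduction with
  | self => exact ⟨s, subset_rfl, rfl, (mul_comm _ _).le⟩
  | of_succ m hm ih =>
    obtain ⟨t, hts, htc, ht⟩ := ih
    obtain ⟨x, hx, hmax⟩ := t.exists_max_image w (Finset.card_pos.1 (by omega))
    refine ⟨t.erase x, (Finset.erase_subset _ _).trans hts, by
      rw [Finset.card_erase_of_mem hx]; omega, ?_⟩
    have h1 : ∑ i ∈ t, w i ≤ (m + 1 : ℝ) * w x := by
      have := Finset.sum_le_card_nsmul t w (w x) hmax
      rw [htc, nsmul_eq_mul] at this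
      exact_mod_cast this
    have h2 : ∑ i ∈ t.erase x, w i = ∑ i ∈ t, w i - w x := by
      rw [← Finset.add_sum_erase t w hx]; ring
    have hm0 : (0 : ℝ) < m + 1 := by positivity
    refine le_of_mul_le_mul_left ?_ hm0
    push_cast at ht
    have h3 : (m + 1 : ℝ) * ∑ i ∈ t.erase x, w i ≤ m * ∑ i ∈ t, w i := by rw [h2]; linarith
    have hs : (0 : ℝ) ≤ s.card := by positivity
    have h4 := mul_le_mul_of_nonneg_right h3 hs
    have h5 := mul_le_mul_of_nonneg_left ht (Nat.cast_nonneg (α := ℝ) m)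
    linarith

/-! ### Existence of a trimmed optimum -/

theorem mem_fiber {d : ℕ} {O : Finset (Pt d)} {α : Pt d → Pt d} {l f : Pt d} :
    f ∈ fiber O α l ↔ f ∈ O ∧ α f = l := by
  classical
  simp [fiber]

theorem mem_multi {d : ℕ} {O : Finset (Pt d)} {α : Pt d → Pt d} {f : Pt d} :
    f ∈ multi O α ↔ f ∈ O ∧ 2 ≤ (fiber O α (α f)).card := by
  classical
  simp [multi]

/-- For each `l` one nearest center `κ l` of its fiber is protected. The clients of a removed `f` go
to `κ (α f)`, which is no further from `α f` than `f` is. The constant 18 comes from `(3 x + 2 y) ^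
2 ≤ 18 x ^ 2 + 8 y ^ 2`. -/
theorem exists_isTrimmed {d : ℕ} {ε : ℝ} (hε : 0 < ε) (hε1 : ε ≤ 1) (P O A : Finset (Pt d))
    {α : Pt d → Pt d} (hα : IsNearestMap A α) (hO : O.Nonempty) :
    ∃ O', IsTrimmed 18 ε P O A α O' := by
  classical
  obtain ⟨β, hβ⟩ := exists_isNearestMap hO
  have hκ : ∀ l, ∃ f, (fiber O α l).Nonempty →
      f ∈ fiber O α l ∧ ∀ g ∈ fiber O α l, dist l f ≤ dist l g := by
    intro l
    by_cases h : (fiber O α l).Nonempty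
    · obtain ⟨f, hf, hmin⟩ := (fiber O α l).exists_min_image (fun g => dist l g) h
      exact ⟨f, fun _ => ⟨hf, hmin⟩⟩
    · exact ⟨0, fun h' => absurd h' h⟩
  choose κ hκ using hκ
  have hself : ∀ f ∈ O, f ∈ fiber O α (α f) := fun f hf => mem_fiber.2 ⟨hf, rfl⟩
  set R := (multi O α).filter fun f => f ≠ κ (α f) with hR
  -- Each protected center of `multi` shares its fiber with an unprotected one, and distinct
  -- protected centers lie in distinct fibers. So an `ε / 2` fraction of `multi` is at most an `ε`
  -- fraction of `R`.
  have hcard : (multi O α).card ≤ 2 * R.card := by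
    have h1 : ∀ f ∈ (multi O α).filter (fun f => ¬ f ≠ κ (α f)), ∃ g ∈ R, α g = α f := by
      intro f hf
      obtain ⟨hfm, hfk⟩ := Finset.mem_filter.1 hf
      obtain ⟨hfO, hf2⟩ := mem_multi.1 hfm
      obtain ⟨g, hg, hgf⟩ := Finset.exists_mem_ne (by omega : 1 < (fiber O α (α f)).card) f
      obtain ⟨hgO, hga⟩ := mem_fiber.1 hg
      refine ⟨g, Finset.mem_filter.2 ⟨mem_multi.2 ⟨hgO, by rwa [hga]⟩, ?_⟩, hga⟩
      rw [hga, ← not_not.1 hfk]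
      exact hgf
    choose! γ hγR hγ using h1
    have h2 : ((multi O α).filter (fun f => ¬ f ≠ κ (α f))).card ≤ R.card := by
      refine Finset.card_le_card_of_injOn γ (fun f hf => hγR f hf) ?_
      intro f hf g hg hfg
      have h3 : α f = α g := by rw [← hγ f hf, ← hγ g hg, hfg]
      have h4 := not_not.1 (Finset.mem_filter.1 hf).2
      have h5 := not_not.1 (Finset.mem_filter.1 hg).2
      rw [h4, h5, h3]
    have h3 : R.card + ((multi O α).filter (fun f => ¬ f ≠ κ (α f))).card = (multi O α).card :=
      Finset.card_filter_add_card_filter_not _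
    omega
  have hcardR : ε * (multi O α).card / 2 ≤ ε * R.card := by
    have : ((multi O α).card : ℝ) ≤ 2 * R.card := by exact_mod_cast hcard
    nlinarith
  have hfloor : (⌊ε * (multi O α).card / 2⌋₊ : ℝ) ≤ ε * R.card :=
    (Nat.floor_le (by positivity)).trans hcardR
  have hle : ⌊ε * (multi O α).card / 2⌋₊ ≤ R.card := by
    have : (⌊ε * (multi O α).card / 2⌋₊ : ℝ) ≤ R.card :=
      hfloor.trans (mul_le_of_le_one_left (by positivity) hε1)
    exact_mod_cast this
  let c : Pt d → ℝ := fun p => 18 * distTo O p ^ 2 + 8 * distTo A p ^ 2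
  have hc : ∀ p, 0 ≤ c p := fun p => by positivity
  obtain ⟨H, hHR, hHc, hHw⟩ := exists_subset_card_sum_mul_le R
    (fun f => ∑ p ∈ P with β p = f, c p) hle
  simp only [Finset.sum_fiberwise_eq_sum_filter] at hHw
  have hHw' : ∑ p ∈ P with β p ∈ H, c p ≤ ε * ∑ p ∈ P, c p := by
    rcases Nat.eq_zero_or_pos R.card with h0 | h0
    · have : H = ∅ := Finset.subset_empty.1 (by rwa [Finset.card_eq_zero.1 h0] at hHR)
      rw [this]
      simpa using mul_nonneg hε.le (Finset.sum_nonneg fun p _ => hc p)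
    · have h0' : (0 : ℝ) < R.card := by exact_mod_cast h0
      refine le_of_mul_le_mul_right (hHw.trans ?_) h0'
      have h1 : ∑ p ∈ P with β p ∈ R, c p ≤ ∑ p ∈ P, c p :=
        Finset.sum_le_sum_of_subset_of_nonneg (Finset.filter_subset _ _) fun p _ _ => hc p
      have h2 : 0 ≤ ∑ p ∈ P, c p := Finset.sum_nonneg fun p _ => hc p
      calc (⌊ε * (multi O α).card / 2⌋₊ : ℝ) * ∑ p ∈ P with β p ∈ R, c p
          ≤ (ε * R.card) * ∑ p ∈ P, c p := by gcongr
        _ = _ := by ring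
  have hkeep : ∀ f ∈ O, κ (α f) ∈ O \ H := by
    intro f hf
    have h1 := (hκ (α f) ⟨f, hself f hf⟩).1
    refine Finset.mem_sdiff.2 ⟨(mem_fiber.1 h1).1, fun h2 => ?_⟩
    have h3 := (Finset.mem_filter.1 (hHR h2)).2
    rw [(mem_fiber.1 h1).2] at h3
    exact h3 rfl
  refine ⟨O \ H, H, hHR.trans (Finset.filter_subset _ _), rfl, hHc, ?_, ?_⟩
  · intro l _ hl
    obtain ⟨h1, h2⟩ := hκ l hl
    refine ⟨κ l, h1, ?_, h2⟩
    have h3 := hkeep (κ l) (mem_fiber.1 h1).1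
    rw [(mem_fiber.1 h1).2] at h3
    exact (Finset.mem_sdiff.1 h3).2
  · have hpt : ∀ p ∈ P, distTo (O \ H) p ^ 2 ≤ distTo O p ^ 2 + if β p ∈ H then c p else 0 := by
      intro p _
      have hOp := hβ.distTo_eq p
      split_ifs with hp
      · have h1 := hβ p
        obtain ⟨h2, h3⟩ := hκ (α (β p)) ⟨_, hself _ h1.1⟩
        have h4 := distTo_le (hkeep _ h1.1) p
        have h5 := h3 _ (hself _ h1.1)
        have h6 := hα.dist_map_le p (β p)
        have h7 := dist_triangle p (α (β p)) (κ (α (β p)))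
        have h8 := dist_triangle (α (β p)) p (β p)
        rw [dist_comm (α (β p)) p] at h8
        have h9 : distTo (O \ H) p ≤ 3 * distTo O p + 2 * distTo A p := by
          have h10 := (hα (β p)).2 (α p) (hα p).1
          have h11 := dist_triangle (β p) p (α p)
          rw [dist_comm (α (β p)) (β p)] at h5
          rw [dist_comm (β p) p, ← hα.distTo_eq p] at h11
          linarith
        have h12 : distTo (O \ H) p ^ 2 ≤ (3 * distTo O p + 2 * distTo A p) ^ 2 :=
          pow_le_pow_left₀ (distTo_nonneg _ _) h9 2
        simp only [c]
        nlinarith [sq_nonneg (3 * distTo O p - 2 * distTo A p), sq_nonneg (distTo O p)]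
      · rw [add_zero]
        refine pow_le_pow_left₀ (distTo_nonneg _ _) ?_ 2
        rw [hOp]
        exact distTo_le (Finset.mem_sdiff.2 ⟨(hβ p).1, hp⟩) p
    have hsum := Finset.sum_le_sum hpt
    rw [Finset.sum_add_distrib, ← Finset.sum_filter] at hsum
    have hcs : ∑ p ∈ P, c p = 18 * cost P O + 8 * cost P A := by
      simp only [c, cost, Finset.sum_add_distrib, Finset.mul_sum]
    rw [hcs] at hHw'
    have hA0 : 0 ≤ cost P A := Finset.sum_nonneg fun p _ => sq_nonneg _
    change cost P (O \ H) ≤ cost P O + _ at hsum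
    nlinarith [mul_nonneg hε.le hA0]

/-! ### Exchanging centers -/

/-- A center of `O` outside `multi` is alone in its fiber, so on these centers `α` is a bijection
onto the `l` with a one-element fiber. -/
theorem card_filter_not_multi {d : ℕ} [DecidableEq (Pt d)] (O B : Finset (Pt d))
    (α : Pt d → Pt d) :
    ((O \ multi O α).filter fun f => α f ∈ B).card =
      (B.filter fun l => (fiber O α l).card = 1).card := by
  classical
  rw [Finset.card_eq_sum_card_fiberwise (f := α) (t := B)
    (s := (O \ multi O α).filter fun f => α f ∈ B) (fun f hf => (Finset.mem_filter.1 hf).2), Finset.card_filter]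
  refine Finset.sum_congr rfl fun l hl => ?_
  have hset : ((O \ multi O α).filter fun f => α f ∈ B).filter (fun f => α f = l) =
      (fiber O α l).filter fun _ => ¬ 2 ≤ (fiber O α l).card := by
    ext f
    simp only [Finset.mem_filter, Finset.mem_sdiff, mem_multi, mem_fiber]
    constructor
    · rintro ⟨⟨⟨h1, h2⟩, -⟩, h4⟩
      subst h4
      exact ⟨⟨h1, rfl⟩, fun h => h2 ⟨h1, h⟩⟩
    · rintro ⟨⟨h1, h2⟩, h3⟩
      subst h2
      exact ⟨⟨⟨h1, fun h => h3 h.2⟩, hl⟩, rfl⟩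
  rw [hset]
  split_ifs with h
  · rw [Finset.filter_true_of_mem fun _ _ => by omega, h]
  · by_cases h2 : 2 ≤ (fiber O α l).card
    · rw [Finset.filter_false_of_mem fun _ _ => not_not.2 h2, Finset.card_empty]
    · rw [Finset.filter_true_of_mem fun _ _ => h2]; omega

theorem card_filter_fiber_ne_one {d : ℕ} {O A : Finset (Pt d)} {α : Pt d → Pt d}
    (hα : IsNearestMap A α) (hc : O.card = A.card) :
    (A.filter fun l => (fiber O α l).card ≠ 1).card = (multi O α).card := by
  classical
  have h1 := card_filter_not_multi O A α
  rw [Finset.filter_true_of_mem fun f _ => (hα f).1, Finset.card_sdiff_of_subset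
    (fun f hf => (mem_multi.1 hf).1)] at h1
  have h2 := Finset.card_filter_add_card_filter_not (s := A) (fun l => (fiber O α l).card = 1)
  have h3 : (multi O α).card ≤ O.card := Finset.card_le_card fun f hf => (mem_multi.1 hf).1
  simp only [ne_eq]
  omega

/-- A set `B` of centers of `A` can be added to the solution `O` at the expense of the centers whose
closest center lies in `B`, and of a light part of `H`. -/
theorem exists_exchange {d : ℕ} {Cand O A B H : Finset (Pt d)} {k : ℕ} {α : Pt d → Pt d}
    (hO : IsSolution Cand k O) (hA : IsSolution Cand k A) (hBA : B ⊆ A) (hH : H ⊆ multi O α)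
    (hn : (B.filter fun l => (fiber O α l).card ≠ 1).card ≤ H.card) (w : Pt d → ℝ) :
    ∃ S H₁ : Finset (Pt d), IsSolution Cand k S ∧ B ⊆ S ∧ H₁ ⊆ H ∧
      (∑ f ∈ H₁, w f) * H.card ≤
        ((B.filter fun l => (fiber O α l).card ≠ 1).card : ℝ) * ∑ f ∈ H, w f ∧
      ∀ f ∈ O, f ∉ H₁ → f ∈ S ∨ α f ∈ B := by
  classical
  obtain ⟨H₁, hH₁, hcard, hw⟩ := exists_subset_card_sum_mul_le H w hn
  set R := (O \ multi O α).filter fun f => α f ∈ B with hR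
  have hRO : R ⊆ O := (Finset.filter_subset _ _).trans Finset.sdiff_subset
  have hHO : H₁ ⊆ O := hH₁.trans (hH.trans fun f hf => (mem_multi.1 hf).1)
  have hdisj : Disjoint R H₁ := by
    rw [Finset.disjoint_left]
    intro f hf hf'
    exact (Finset.mem_sdiff.1 (Finset.mem_filter.1 hf).1).2 (hH (hH₁ hf'))
  have hRc : R.card = _ := card_filter_not_multi O B α
  have hBc := Finset.card_filter_add_card_filter_not (s := B) (fun l => (fiber O α l).card = 1)
  -- `R` makes room for the centers of `B` with a one-element fiber and `H₁` for all the others.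
  have hTc : ((O \ (R ∪ H₁)) ∪ B).card ≤ k := by
    refine (Finset.card_union_le _ _).trans ?_
    rw [Finset.card_sdiff_of_subset (Finset.union_subset hRO hHO), Finset.card_union_of_disjoint hdisj,
      hO.2]
    have h1 : (R ∪ H₁).card ≤ k := hO.2 ▸ Finset.card_le_card (Finset.union_subset hRO hHO)
    rw [Finset.card_union_of_disjoint hdisj] at h1
    simp only [ne_eq] at hcard
    omega
  have hTC : (O \ (R ∪ H₁)) ∪ B ⊆ Cand :=
    Finset.union_subset (Finset.sdiff_subset.trans hO.1) (hBA.trans hA.1)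
  -- `B` may meet the part of `O` that is kept, so the set may be too small; it is filled up with
  -- arbitrary candidates.
  obtain ⟨S, hTS, hSC, hSc⟩ := Finset.exists_subsuperset_card_eq hTC hTc
    (hO.2 ▸ Finset.card_le_card hO.1)
  refine ⟨S, H₁, ⟨hSC, hSc⟩, Finset.subset_union_right.trans hTS, hH₁, hw, fun f hf hfH => ?_⟩
  by_cases hfR : f ∈ R
  · exact Or.inr (Finset.mem_filter.1 hfR).2
  · refine Or.inl (hTS (Finset.mem_union_left _ (Finset.mem_sdiff.2 ⟨hf, ?_⟩)))
    rw [Finset.mem_union]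
    tauto

/-! ### Detours are paid for by the budget -/

theorem b₁_nonneg {d : ℕ} (D : HierDecomp (Pt d)) {δ : ℝ} (hδ : 0 < δ) (A : Finset (Pt d))
    (p : Pt d) : 0 ≤ b₁ D δ A p := by
  have := distTo_nonneg A p
  unfold b₁
  split_ifs
  · exact det_nonneg D hδ p (by positivity)
  · exact le_rfl

theorem b₂_nonneg {d : ℕ} (D : HierDecomp (Pt d)) {δ : ℝ} (hδ : 0 < δ) (A S : Finset (Pt d))
    (p : Pt d) : 0 ≤ b₂ D δ A S p := by
  have := distTo_nonneg A p
  have := distTo_nonneg S p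
  unfold b₂
  split_ifs
  · exact det_nonneg D hδ p (by positivity)
  · positivity

theorem b₃_nonneg {d : ℕ} (D : HierDecomp (Pt d)) {δ : ℝ} (hδ : 0 < δ) (α : Pt d → Pt d)
    (S : Finset (Pt d)) (p : Pt d) : 0 ≤ b₃ D δ α S p := by
  have := distTo_nonneg S (α p)
  unfold b₃
  split_ifs
  · exact det_nonneg D hδ _ (by positivity)
  · exact le_rfl

/-- A detour between two points of a ball is paid for by the detour of the ball. -/
theorem sq_add_detour_le {d : ℕ} (D : HierDecomp (Pt d)) {ρ a r : ℝ} (hρ : 0 < ρ) (ha : 0 ≤ a)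
    (har : a ≤ r) {c : Pt d} {lam : ℝ} (hlam : 0 ≤ lam) (hlam' : lam ≤ pow2 (ballLevel D c r)) :
    (a + ρ * lam) ^ 2 ≤ a ^ 2 + det D (2 * ρ) c r := by
  unfold det
  set L := pow2 (ballLevel D c r)
  have h1 : ρ * lam ≤ ρ * L := by gcongr
  have h0 : 0 ≤ ρ * lam := by positivity
  have hL0 : 0 ≤ ρ * L := h0.trans h1
  have h2 : (ρ * lam) * a ≤ (ρ * L) * r := by gcongr
  have h3 : (ρ * lam) ^ 2 ≤ (ρ * L) ^ 2 := by gcongr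
  -- The cross term of the square is `2 ρ lam a`, which is why the budget parameter is twice the
  -- portal parameter.
  nlinarith [sq_nonneg (ρ * L)]

theorem pow2_level_pair_le {d : ℕ} (D : HierDecomp (Pt d)) {x y c : Pt d} {r : ℝ}
    (hx : dist x c ≤ r) (hy : dist y c ≤ r) : pow2 (D.level {x, y}) ≤ pow2 (ballLevel D c r) := by
  refine pow2_mono (D.level_mono ?_)
  rintro z (rfl | rfl)
  · exact hx
  · exact hy

/-- With `l = α p`: if `l ∉ S` then `B(l, 3 O'_l)` is not badly cut, so `b₃` is a true detour. A
moved client starts at `l` and is paid for by `b₃` or `b₂`. A client that stays uses `b₁` or `b₂`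
for its nearest center; if neither works, it connects to a center of `S` near `l`. -/
theorem exists_detour_le_budget {d : ℕ} (hd : 0 < d) {bot top : ℤ} {u : Fin d → ℝ} {ρ : ℝ}
    (hρ : 0 < ρ) {A O' S : Finset (Pt d)} {α : Pt d → Pt d} (hα : IsNearestMap A α)
    (hB : badCenters (quadtree d bot top u) (2 * ρ) A O' ⊆ S)
    (hS : ∀ x, ∃ t ∈ S, dist x t ≤ 2 * distTo O' x + distTo A x) (p : Pt d) :
    ∃ s ∈ S, (dist p (moved (quadtree d bot top u) (2 * ρ) A α p)
          + dist (moved (quadtree d bot top u) (2 * ρ) A α p) s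
          + ρ * pow2 ((quadtree d bot top u).level
            {moved (quadtree d bot top u) (2 * ρ) A α p, s})) ^ 2
        ≤ (dist p (moved (quadtree d bot top u) (2 * ρ) A α p)
            + distTo S (moved (quadtree d bot top u) (2 * ρ) A α p)) ^ 2
          + budget (quadtree d bot top u) (2 * ρ) A α O' p := by
  classical
  set D := quadtree d bot top u
  have hδ : 0 < 2 * ρ := by positivity
  have hd1 : (1 : ℝ) ≤ d := by exact_mod_cast hd
  have hb1 := b₁_nonneg D hδ A p
  have hb2 := b₂_nonneg D hδ A O' p
  have hb3 := b₃_nonneg D hδ α O' p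
  obtain ⟨t₀, ht₀, -⟩ := hS p
  obtain ⟨β, hβ⟩ := exists_isNearestMap ⟨t₀, ht₀⟩
  have hA := hα.distTo_eq p
  have hA0 := distTo_nonneg A p
  have hO0 := distTo_nonneg O' p
  have hOl0 := distTo_nonneg O' (α p)
  have hOl := distTo_le_add O' (α p) p
  rw [dist_comm, ← hA] at hOl
  obtain ⟨t, ht, htl⟩ := hS (α p)
  rw [distTo_eq_zero (hα p).1, add_zero] at htl
  have hSp : distTo S p ≤ 2 * distTo O' p + distTo A p := by
    obtain ⟨t', ht', h⟩ := hS p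
    exact (distTo_le ht' p).trans h
  have hSl := (distTo_le ht (α p)).trans htl
  have hlev0 : ∀ T, 0 ≤ pow2 (D.level T) := fun T => pow2_nonneg _
  have hlevel3 : α p ∉ S → LevelLe D (2 * ρ) (α p) (3 * distTo O' (α p)) := fun hl =>
    levelLe_of_not_badlyCut fun hbad => hl (hB (Finset.mem_filter.2 ⟨(hα p).1, hbad⟩))
  unfold budget
  by_cases hp : BadlyCut D (2 * ρ) p (3 * distTo A p)
  · have hm : moved D (2 * ρ) A α p = α p := if_pos hp
    rw [hm, ← hA]
    by_cases hl : α p ∈ S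
    · refine ⟨α p, hl, ?_⟩
      have hz : distTo S (α p) = 0 :=
        le_antisymm ((distTo_le hl _).trans (dist_self _).le) (distTo_nonneg _ _)
      rw [D.level_singleton, hz, pow2_bot, dist_self]
      linarith
    · have hle3 := hlevel3 hl
      have hb3' : b₃ D (2 * ρ) α O' p = det D (2 * ρ) (α p) (3 * distTo O' (α p)) := if_pos hle3
      refine ⟨β (α p), (hβ _).1, ?_⟩
      rw [hβ.distTo_eq (α p)] at hSl ⊢
      have ha0 := dist_nonneg (x := α p) (y := β (α p))
      set a := dist (α p) (β (α p)) with ha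
      set lam := pow2 (D.level {α p, β (α p)})
      have hlam0 : 0 ≤ lam := hlev0 _
      have hlam3 : lam ≤ pow2 (ballLevel D (α p) (3 * distTo O' (α p))) :=
        pow2_level_pair_le D (by rw [dist_self]; positivity)
          (by rw [dist_comm, ← ha]; linarith)
      -- If `A_p ≤ O'_l`, the whole route has length at most `3 O'_l` and `b₃` pays for it.
      rcases le_total (distTo A p) (distTo O' (α p)) with hcase | hcase
      · have := sq_add_detour_le D hρ (by positivity : 0 ≤ distTo A p + a)
          (by linarith : distTo A p + a ≤ 3 * distTo O' (α p)) hlam0 hlam3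
        linarith
      · have hbound3 := hle3.mul_pow2_le hd hδ (by positivity)
        by_cases hle2 : LevelLe D (2 * ρ) p (3 * (distTo A p + distTo O' p))
        · have hb2' : b₂ D (2 * ρ) A O' p = det D (2 * ρ) p (3 * (distTo A p + distTo O' p)) :=
            if_pos hle2
          have hbound1 := hp.le_mul_pow2 hd hδ
          have hmono : pow2 (ballLevel D p (3 * distTo A p)) ≤
              pow2 (ballLevel D p (3 * (distTo A p + distTo O' p))) :=
            pow2_mono (D.level_mono (Metric.closedBall_subset_closedBall (by linarith)))
          -- Levels of balls around different points are compared through their radii: `B(l, 3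
          -- O'_l)` is not badly cut, `B(p, 3 A_p)` is, and `O'_l ≤ A_p`.
          have hlam2 : lam ≤ pow2 (ballLevel D p (3 * (distTo A p + distTo O' p))) := by
            refine hlam3.trans (le_trans ?_ hmono)
            refine le_of_mul_le_mul_left (hbound3.trans (le_trans ?_ hbound1)) hδ
            gcongr
          have := sq_add_detour_le D hρ (by positivity : 0 ≤ distTo A p + a)
            (by linarith : distTo A p + a ≤ 3 * (distTo A p + distTo O' p)) hlam0 hlam2
          linarith
        · have hb2' : b₂ D (2 * ρ) A O' p = 36 * d * distTo A p ^ 2 + 16 * d * distTo O' p ^ 2 :=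
            if_neg hle2
          -- Here `b₃` pays for the leg from `l` only; the cross term with `A_p` is at most `3 d A_p
          -- ^ 2` and is left to the quadratic value of `b₂`.
          have h1 := sq_add_detour_le D hρ ha0
            (by linarith : a ≤ 3 * distTo O' (α p)) hlam0 hlam3
          have h2 : 2 * ρ * lam * distTo A p ≤ 3 * d * distTo A p ^ 2 := by
            have h3 : 2 * ρ * lam ≤ d * (3 * distTo A p) := by
              calc 2 * ρ * lam ≤ 2 * ρ * pow2 (ballLevel D (α p) (3 * distTo O' (α p))) := by
                    gcongr
                _ ≤ d * (3 * distTo O' (α p)) := hbound3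
                _ ≤ _ := by gcongr
            nlinarith
          have h4 : 0 ≤ d * distTo A p ^ 2 := by positivity
          have h5 : 0 ≤ d * distTo O' p ^ 2 := by positivity
          rw [hb3', hb2']
          nlinarith
  · have hm : moved D (2 * ρ) A α p = p := if_neg hp
    have hb1' : b₁ D (2 * ρ) A p = det D (2 * ρ) p (3 * distTo A p) :=
      if_pos (levelLe_of_not_badlyCut hp)
    rw [hm, dist_self]
    simp only [zero_add]
    by_cases hnear : distTo S p ≤ 3 * distTo A p
    · refine ⟨β p, (hβ p).1, ?_⟩
      rw [hβ.distTo_eq p] at hnear ⊢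
      have := sq_add_detour_le D hρ dist_nonneg hnear (hlev0 {p, β p})
        (pow2_level_pair_le D (by rw [dist_self]; positivity) (by rwa [dist_comm]))
      linarith
    · by_cases hle2 : LevelLe D (2 * ρ) p (3 * (distTo A p + distTo O' p))
      · have hb2' : b₂ D (2 * ρ) A O' p = det D (2 * ρ) p (3 * (distTo A p + distTo O' p)) :=
          if_pos hle2
        refine ⟨β p, (hβ p).1, ?_⟩
        rw [hβ.distTo_eq p] at hSp ⊢
        have hr : dist p (β p) ≤ 3 * (distTo A p + distTo O' p) := by linarith
        have := sq_add_detour_le D hρ dist_nonneg hr (hlev0 {p, β p})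
          (pow2_level_pair_le D (by rw [dist_self]; positivity) (by rwa [dist_comm]))
        linarith
      · have hb2' : b₂ D (2 * ρ) A O' p = 36 * d * distTo A p ^ 2 + 16 * d * distTo O' p ^ 2 :=
          if_neg hle2
        have hl : α p ∉ S := fun hl => hnear (by
          have := distTo_le hl p
          rw [← hA] at this
          linarith)
        have hb3' : b₃ D (2 * ρ) α O' p = det D (2 * ρ) (α p) (3 * distTo O' (α p)) :=
          if_pos (hlevel3 hl)
        have hpt := dist_triangle p (α p) t
        rw [← hA] at hpt
        have hnear' := distTo_le ht p
        push Not at hnear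
        -- From `3 A_p < S_p ≤ A_p + 2 O'_l` it follows that `A_p < O'_l`, so `p` and `t` both lie
        -- in `B(l, 3 O'_l)`. As `t` need not be nearest to `p`, `b₂` pays for the squared distance
        -- itself and `b₃` for the detour.
        have hr : dist p t ≤ 3 * distTo O' (α p) := by linarith
        refine ⟨t, ht, ?_⟩
        have h1 := sq_add_detour_le D hρ dist_nonneg hr (hlev0 {p, t})
          (pow2_level_pair_le D (c := α p) (by rw [← hA]; linarith)
            (by rw [dist_comm]; linarith))
        have h2 : dist p t ≤ 3 * distTo A p + 2 * distTo O' p := by linarith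
        have h3 : dist p t ^ 2 ≤ (3 * distTo A p + 2 * distTo O' p) ^ 2 := by gcongr
        have h4 : 1 * distTo A p ^ 2 ≤ d * distTo A p ^ 2 := by gcongr
        have h5 : 1 * distTo O' p ^ 2 ≤ d * distTo O' p ^ 2 := by gcongr
        rw [hb3', hb2']
        nlinarith [sq_nonneg (3 * distTo A p - 2 * distTo O' p), sq_nonneg (distTo S p)]

/-! ### The expected budget -/

/-- A random upper bound for the budget of `p`. -/
noncomputable def budgetBound (d : ℕ) (top : ℤ) (δ : ℝ) (A S : Finset (Pt d)) (α : Pt d → Pt d)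
    (p : Pt d) (u : Fin d → ℝ) : ℝ :=
  δ * (1 + d) * (3 * distTo A p) * levelBound d top δ p (3 * distTo A p) u
  + (δ * (1 + d) * (3 * (distTo A p + distTo S p)) *
      levelBound d top δ p (3 * (distTo A p + distTo S p)) u
    + (36 * d * distTo A p ^ 2 + 16 * d * distTo S p ^ 2) *
      badCount d top δ p (3 * (distTo A p + distTo S p)) u)
  + δ * (1 + d) * (3 * distTo S (α p)) * levelBound d top δ (α p) (3 * distTo S (α p)) u

theorem budget_le_budgetBound {d : ℕ} (hd : 0 < d) {bot top : ℤ} {δ : ℝ} (hδ : 0 < δ)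
    (A S : Finset (Pt d)) (α : Pt d → Pt d) (p : Pt d) (u : Fin d → ℝ) :
    budget (quadtree d bot top u) δ A α S p ≤ budgetBound d top δ A S α p u := by
  have hA := distTo_nonneg A p
  have hS := distTo_nonneg S p
  have hSl := distTo_nonneg S (α p)
  have hdet : ∀ (x : Pt d) {r : ℝ}, 0 ≤ r → 0 ≤ δ * (1 + d) * r * levelBound d top δ x r u :=
    fun x r hr => mul_nonneg (by positivity) (levelBound_nonneg hd _ _ _ hr _)
  unfold budget budgetBound b₁ b₂ b₃
  refine add_le_add (add_le_add ?_ ?_) ?_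
  · split_ifs with h
    · exact h.det_le hd hδ (by positivity)
    · exact hdet _ (by positivity)
  · have hr : 0 ≤ 3 * (distTo A p + distTo S p) := by positivity
    have hc : 0 ≤ 36 * d * distTo A p ^ 2 + 16 * d * distTo S p ^ 2 := by positivity
    split_ifs with h
    · exact (h.det_le hd hδ hr).trans
        (le_add_of_nonneg_right (mul_nonneg hc (badCount_nonneg hd _ _ _ hr _)))
    · exact (le_mul_of_one_le_right hc (one_le_badCount hd (badlyCut_of_not_levelLe h))).trans
        (le_add_of_nonneg_left (hdet _ hr))
  · split_ifs with h
    · exact h.det_le hd hδ (by positivity)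
    · exact hdet _ (by positivity)

theorem budgetBound_nonneg {d : ℕ} (hd : 0 < d) {top : ℤ} {δ : ℝ} (hδ : 0 < δ)
    (A S : Finset (Pt d)) (α : Pt d → Pt d) (p : Pt d) (u : Fin d → ℝ) :
    0 ≤ budgetBound d top δ A S α p u := by
  refine le_trans ?_ (budget_le_budgetBound (bot := top) hd hδ A S α p u)
  exact add_nonneg (add_nonneg (b₁_nonneg _ hδ _ _) (b₂_nonneg _ hδ _ _ _)) (b₃_nonneg _ hδ _ _ _)

theorem integrable_integral_budgetBound_le {d : ℕ} (hd : 0 < d) (top : ℤ) {δ : ℝ} (hδ : 0 < δ)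
    (hτ : 0 ≤ tau δ d) (A S : Finset (Pt d)) {α : Pt d → Pt d} (hα : IsNearestMap A α) (p : Pt d) :
    Integrable (budgetBound d top δ A S α p) (shiftLaw d) ∧
    ∫ u, budgetBound d top δ A S α p u ∂(shiftLaw d) ≤
      (90 * (1 + d) + 36) * d * Real.sqrt d * (δ * (1 + tau δ d)) *
        (distTo A p ^ 2 + distTo S p ^ 2) := by
  have hA := distTo_nonneg A p
  have hS := distTo_nonneg S p
  have hSl := distTo_nonneg S (α p)
  have hSl' := distTo_le_add S (α p) p
  rw [dist_comm, ← hα.distTo_eq p] at hSl'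
  have hL : ∀ (x : Pt d) {r : ℝ}, 0 ≤ r →
      Integrable (fun u => δ * (1 + d) * r * levelBound d top δ x r u) (shiftLaw d) ∧
      ∫ u, δ * (1 + d) * r * levelBound d top δ x r u ∂(shiftLaw d) ≤
        2 * (1 + d) * d * Real.sqrt d * (δ * (1 + tau δ d)) * r ^ 2 := by
    intro x r hr
    refine ⟨(integrable_levelBound hd top δ x hr).const_mul _, ?_⟩
    rw [integral_const_mul]
    refine (mul_le_mul_of_nonneg_left (integral_levelBound_le hd top hτ x hr)
      (by positivity)).trans (le_of_eq (by ring))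
  have hr1 : 0 ≤ 3 * distTo A p := by positivity
  have hr2 : 0 ≤ 3 * (distTo A p + distTo S p) := by positivity
  have hr3 : 0 ≤ 3 * distTo S (α p) := by positivity
  have h1 := hL p hr1
  have h2 := hL p hr2
  have h3 := hL (α p) hr3
  have hb := (integrable_badCount hd top δ p hr2).const_mul
    (36 * d * distTo A p ^ 2 + 16 * d * distTo S p ^ 2)
  refine ⟨(h1.1.add (h2.1.add hb)).add h3.1, ?_⟩
  unfold budgetBound
  rw [integral_add (by exact h1.1.add (h2.1.add hb)) h3.1,
    integral_add h1.1 (by exact h2.1.add hb), integral_add h2.1 hb, integral_const_mul (36 * d * distTo A p ^ 2 + 16 * d * distTo S p ^ 2)]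
  have hd' : (0 : ℝ) < d := by exact_mod_cast hd
  have hbad : (36 * d * distTo A p ^ 2 + 16 * d * distTo S p ^ 2) *
      ∫ u, badCount d top δ p (3 * (distTo A p + distTo S p)) u ∂(shiftLaw d) ≤
      36 * d * Real.sqrt d * (δ * (1 + tau δ d)) * (distTo A p ^ 2 + distTo S p ^ 2) := by
    calc _ ≤ (36 * d * distTo A p ^ 2 + 36 * d * distTo S p ^ 2) *
          (Real.sqrt d * (δ * (1 + tau δ d))) := by
          have h4 := integral_badCount_le hd top hδ p hr2
          have h5 : Real.sqrt d * δ ≤ Real.sqrt d * (δ * (1 + tau δ d)) := by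
            gcongr; nlinarith
          have h6 : (0 : ℝ) ≤ ∫ u, badCount d top δ p (3 * (distTo A p + distTo S p)) u
              ∂(shiftLaw d) := integral_nonneg fun u => badCount_nonneg hd _ _ _ hr2 _
          have h7 := h4.trans h5
          gcongr
          norm_num
      _ = _ := by ring
  set K := d * Real.sqrt d * (δ * (1 + tau δ d)) with hK
  have hK0 : 0 ≤ K := by positivity
  -- By `O'_l ≤ A_p + O'_p` the three squared radii sum to at most 45 times the squared distances;
  -- with the factor `2 (1 + d)` of each detour this gives `90 (1 + d)`.
  have hrsq : (3 * distTo A p) ^ 2 + (3 * (distTo A p + distTo S p)) ^ 2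
      + (3 * distTo S (α p)) ^ 2 ≤ 45 * (distTo A p ^ 2 + distTo S p ^ 2) := by
    have : distTo S (α p) ^ 2 ≤ (distTo A p + distTo S p) ^ 2 :=
      pow_le_pow_left₀ hSl (by linarith) 2
    nlinarith [sq_nonneg (distTo A p - distTo S p), sq_nonneg (distTo S p)]
  have hmul := mul_le_mul_of_nonneg_left hrsq (by positivity : 0 ≤ 2 * (1 + d) * K)
  have e1 : ∀ y : ℝ, 2 * (1 + d) * d * Real.sqrt d * (δ * (1 + tau δ d)) * y =
      2 * (1 + d) * K * y := fun y => by rw [hK]; ring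
  have e2 : (90 * (1 + d) + 36) * d * Real.sqrt d * (δ * (1 + tau δ d)) =
      (90 * (1 + d) + 36) * K := by rw [hK]; ring
  have e3 : 36 * d * Real.sqrt d * (δ * (1 + tau δ d)) = 36 * K := by rw [hK]; ring
  have i1 := h1.2
  have i2 := h2.2
  have i3 := h3.2
  rw [e1] at i1 i2 i3
  rw [e3] at hbad
  rw [e2]
  linarith

/-! ### The connection cost of the exchanged solution -/

/-- A random upper bound for the cost increase of `p` caused by badly cut balls, where `f` and `g`
are the centers that serve `p` in `O` and in `S`. -/
noncomputable def moveBound (d : ℕ) (top : ℤ) (δ : ℝ) (O A S : Finset (Pt d)) (α : Pt d → Pt d)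
    (f g p : Pt d) (u : Fin d → ℝ) : ℝ :=
  (2 * distTo O p + distTo A p) ^ 2 * badCount d top δ (α f) (3 * distTo S (α f)) u
  + (2 * distTo S p + distTo A p) ^ 2 * badCount d top δ (α g) (3 * distTo S (α g)) u
  + (3 * distTo A p + 2 * distTo S p) ^ 2 * badCount d top δ p (3 * distTo A p) u

theorem moveBound_nonneg {d : ℕ} (hd : 0 < d) (top : ℤ) (δ : ℝ) (O A S : Finset (Pt d))
    (α : Pt d → Pt d) (f g p : Pt d) (u : Fin d → ℝ) :
    0 ≤ moveBound d top δ O A S α f g p u := by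
  have h : ∀ (T : Finset (Pt d)) (x : Pt d), 0 ≤ badCount d top δ x (3 * distTo T x) u :=
    fun T x => badCount_nonneg hd _ _ _ (by have := distTo_nonneg T x; positivity) _
  exact add_nonneg (add_nonneg (mul_nonneg (sq_nonneg _) (h _ _)) (mul_nonneg (sq_nonneg _) (h _ _)))
    (mul_nonneg (sq_nonneg _) (h _ _))

theorem integrable_integral_moveBound_le {d : ℕ} (hd : 0 < d) (top : ℤ) {δ : ℝ} (hδ : 0 < δ)
    (O A S : Finset (Pt d)) (α : Pt d → Pt d) (f g p : Pt d) :
    Integrable (moveBound d top δ O A S α f g p) (shiftLaw d) ∧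
    ∫ u, moveBound d top δ O A S α f g p u ∂(shiftLaw d) ≤
      22 * (Real.sqrt d * δ) * (distTo O p ^ 2 + distTo A p ^ 2 + distTo S p ^ 2) := by
  have hr : ∀ (T : Finset (Pt d)) (x : Pt d), 0 ≤ 3 * distTo T x := fun T x => by
    have := distTo_nonneg T x; positivity
  have hI : ∀ (T : Finset (Pt d)) (x : Pt d) (c : ℝ),
      Integrable (fun u => c ^ 2 * badCount d top δ x (3 * distTo T x) u) (shiftLaw d) :=
    fun T x c => (integrable_badCount hd top δ x (hr T x)).const_mul _
  have hL : ∀ (T : Finset (Pt d)) (x : Pt d) (c : ℝ),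
      ∫ u, c ^ 2 * badCount d top δ x (3 * distTo T x) u ∂(shiftLaw d) ≤
        c ^ 2 * (Real.sqrt d * δ) := fun T x c => by
    rw [integral_const_mul]
    exact mul_le_mul_of_nonneg_left (integral_badCount_le hd top hδ x (hr T x)) (sq_nonneg _)
  refine ⟨((hI _ _ _).add (hI _ _ _)).add (hI _ _ _), ?_⟩
  unfold moveBound
  rw [integral_add (by exact (hI _ _ _).add (hI _ _ _)) (hI _ _ _),
    integral_add (hI _ _ _) (hI _ _ _)]
  refine (add_le_add (add_le_add (hL _ _ _) (hL _ _ _)) (hL _ _ _)).trans ?_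
  rw [← add_mul, ← add_mul, mul_comm (22 : ℝ), mul_assoc, mul_comm]
  refine mul_le_mul_of_nonneg_left ?_ (by positivity)
  nlinarith [sq_nonneg (2 * distTo O p - distTo A p), sq_nonneg (2 * distTo S p - distTo A p),
    sq_nonneg (3 * distTo A p - 2 * distTo S p), sq_nonneg (distTo O p), sq_nonneg (distTo S p)]

open scoped Classical in
-- A moved client is charged to its own bad cut. Otherwise, if its center (`β p`, or `γ p` when `β p
-- ∈ H₁`) is missing from `S`, then the center of `A` nearest to it is badly cut and lies in `S`, at
-- distance controlled by `IsNearestMap.dist_map_le`; the charge goes to that bad cut.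
theorem moved_cost_le {d : ℕ} (hd : 0 < d) {bot top : ℤ} {u : Fin d → ℝ} {δ : ℝ}
    {O A O' S H₁ : Finset (Pt d)} {α β γ : Pt d → Pt d} (hα : IsNearestMap A α)
    (hβ : IsNearestMap O β) (hγ : IsNearestMap O' γ) (hO' : O' ⊆ O)
    (hH : ∀ f ∈ O', f ∉ H₁)
    (hB : badCenters (quadtree d bot top u) δ A O' ⊆ S)
    (hex : ∀ f ∈ O, f ∉ H₁ → f ∈ S ∨ α f ∈ badCenters (quadtree d bot top u) δ A O')
    (hS : ∀ x, ∃ t ∈ S, dist x t ≤ 2 * distTo O' x + distTo A x) (p : Pt d) :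
    (dist p (moved (quadtree d bot top u) δ A α p) +
        distTo S (moved (quadtree d bot top u) δ A α p)) ^ 2 ≤
      distTo O p ^ 2 + (if β p ∈ H₁ then distTo O' p ^ 2 - distTo O p ^ 2 else 0) +
        moveBound d top δ O A O' α (β p) (γ p) p u := by
  set D := quadtree d bot top u
  have hA0 := distTo_nonneg A p
  have hS0 := distTo_nonneg S p
  have hO0 := distTo_nonneg O' p
  have hOO : distTo O p ^ 2 ≤ distTo O' p ^ 2 :=
    pow_le_pow_left₀ (distTo_nonneg _ _) (distTo_anti ⟨γ p, (hγ p).1⟩ hO' p) 2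
  have hbad0 : ∀ (T : Finset (Pt d)) (x : Pt d), 0 ≤ badCount d top δ x (3 * distTo T x) u :=
    fun T x => badCount_nonneg hd _ _ _ (by have := distTo_nonneg T x; positivity) _
  have t1 := mul_nonneg (sq_nonneg (2 * distTo O p + distTo A p)) (hbad0 O' (α (β p)))
  have t2 := mul_nonneg (sq_nonneg (2 * distTo O' p + distTo A p)) (hbad0 O' (α (γ p)))
  have t3 := mul_nonneg (sq_nonneg (3 * distTo A p + 2 * distTo O' p)) (hbad0 A p)
  have hite : 0 ≤ if β p ∈ H₁ then distTo O' p ^ 2 - distTo O p ^ 2 else 0 := by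
    split_ifs
    · linarith
    · exact le_rfl
  have hbadC : ∀ f, α f ∈ badCenters D δ A O' →
      1 ≤ badCount d top δ (α f) (3 * distTo O' (α f)) u := fun f hf =>
    one_le_badCount hd (Finset.mem_filter.1 hf).2
  have hnear : ∀ f, α f ∈ badCenters D δ A O' → distTo S p ≤ 2 * dist p f + distTo A p :=
    fun f hf => (distTo_le (hB hf) p).trans (hα.dist_map_le p f)
  unfold moveBound
  by_cases hp : BadlyCut D δ p (3 * distTo A p)
  · have hm : moved D δ A α p = α p := if_pos hp
    rw [hm, ← hα.distTo_eq p]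
    obtain ⟨t, ht, htl⟩ := hS (α p)
    rw [distTo_eq_zero (hα p).1, add_zero] at htl
    have hSl := (distTo_le ht (α p)).trans htl
    have hOl := distTo_le_add O' (α p) p
    rw [dist_comm, ← hα.distTo_eq p] at hOl
    have hSl0 := distTo_nonneg S (α p)
    have h1 : (distTo A p + distTo S (α p)) ^ 2 ≤ (3 * distTo A p + 2 * distTo O' p) ^ 2 :=
      pow_le_pow_left₀ (by positivity) (by linarith) 2
    have h2 := le_mul_of_one_le_right (sq_nonneg (3 * distTo A p + 2 * distTo O' p))
      (one_le_badCount hd hp)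
    linarith [sq_nonneg (distTo O p)]
  · have hm : moved D δ A α p = p := if_neg hp
    rw [hm, dist_self, zero_add]
    by_cases hβH : β p ∈ H₁
    · rw [if_pos hβH]
      rcases hex (γ p) (hO' (hγ p).1) (hH _ (hγ p).1) with h | h
      · have h1 : distTo S p ^ 2 ≤ distTo O' p ^ 2 :=
          pow_le_pow_left₀ hS0 (by rw [hγ.distTo_eq p]; exact distTo_le h p) 2
        linarith
      · have h1 := hnear _ h
        rw [← hγ.distTo_eq p] at h1
        have h2 := pow_le_pow_left₀ hS0 h1 2
        have h3 := le_mul_of_one_le_right (sq_nonneg (2 * distTo O' p + distTo A p)) (hbadC _ h)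
        linarith [sq_nonneg (distTo O' p)]
    · rw [if_neg hβH]
      rcases hex (β p) (hβ p).1 hβH with h | h
      · have h1 : distTo S p ^ 2 ≤ distTo O p ^ 2 :=
          pow_le_pow_left₀ hS0 (by rw [hβ.distTo_eq p]; exact distTo_le h p) 2
        linarith
      · have h1 := hnear _ h
        rw [← hβ.distTo_eq p] at h1
        have h2 := pow_le_pow_left₀ hS0 h1 2
        have h3 := le_mul_of_one_le_right (sq_nonneg (2 * distTo O p + distTo A p)) (hbadC _ h)
        linarith [sq_nonneg (distTo O p)]

/-! ### The choice of the parameter -/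

theorem tau_nonneg {d : ℕ} (hd : 0 < d) {δ : ℝ} (hδ : 0 < δ) (hδ1 : δ ≤ 1) : 0 ≤ tau δ d := by
  have hd1 : (1 : ℝ) ≤ d := by exact_mod_cast hd
  exact add_nonneg (Real.logb_nonneg (by norm_num) hd1)
    (Real.logb_nonneg (by norm_num) (by rwa [le_div_iff₀ hδ, one_mul]))

theorem one_half_le_log_one_div {ε : ℝ} (hε : 0 < ε) (hε2 : ε ≤ 1 / 2) :
    1 / 2 ≤ Real.log (1 / ε) := by
  have h1 : (2 : ℝ) ≤ 1 / ε := by rw [le_div_iff₀ hε]; linarith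
  have h2 := Real.log_le_log two_pos h1
  have := Real.log_two_gt_d9
  linarith

/-- Since `ρ` may be arbitrarily small, `log (1 / δ)` is not bounded in terms of `ε`. With `y = ε /
Λ` and `Λ = log (1 / ε)`, split it as `log (y / δ) + log Λ + Λ`; the factor `δ` tames the first part
through `log t ≤ 2 √t`, and `δ ≤ s ^ 2 y` the second. -/
theorem exists_parameter {d : ℕ} (hd : 0 < d) {M : ℝ} (hM : 0 < M) :
    ∃ c : ℝ, 0 < c ∧ ∀ ε ρ : ℝ, 0 < ε → ε ≤ 1 / 2 → 0 < ρ → ρ ≤ c * (ε / Real.log (1 / ε)) →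
      2 * ρ ≤ 1 ∧ M * (2 * ρ * (1 + tau (2 * ρ) d)) ≤ ε := by
  have hd1 : (1 : ℝ) ≤ d := by exact_mod_cast hd
  set s : ℝ := 1 / (M * (14 + 4 * d) + 1) with hs
  have hs0 : 0 < s := by positivity
  have hs1 : s ≤ 1 := by
    rw [hs, div_le_one (by positivity)]
    have : 0 < M * (14 + 4 * d) := by positivity
    linarith
  refine ⟨s ^ 2 / 2, by positivity, fun ε ρ hε hε2 hρ hρc => ?_⟩
  set Λ := Real.log (1 / ε) with hΛ
  have hΛ2 : 1 / 2 ≤ Λ := one_half_le_log_one_div hε hε2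
  have hΛ0 : 0 < Λ := by linarith
  set y := ε / Λ with hy
  have hy0 : 0 < y := by positivity
  have hyε : y ≤ 2 * ε := by
    rw [hy, div_le_iff₀ hΛ0]; nlinarith
  have hyΛ : y * Λ = ε := by rw [hy]; field_simp
  set δ := 2 * ρ with hδ
  have hδ0 : 0 < δ := by positivity
  have hδy : δ ≤ s ^ 2 * y := by linarith
  have hss : s ^ 2 ≤ s := by nlinarith
  have hδ1 : δ ≤ 1 := by nlinarith
  refine ⟨hδ1, ?_⟩
  have hlog1 : Real.log (1 / δ) = Real.log (y / δ) + (Real.log Λ + Λ) := by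
    have : Λ = - Real.log ε := by rw [hΛ, one_div, Real.log_inv]
    rw [Real.log_div hy0.ne' hδ0.ne', hy, Real.log_div hε.ne' hΛ0.ne', one_div, Real.log_inv]
    linarith
  have hlog2 : δ * Real.log (y / δ) ≤ 2 * (s * y) := by
    have h1 : Real.log (y / δ) ≤ 2 * Real.sqrt (y / δ) := by
      have h2 := Real.log_le_sub_one_of_pos (Real.sqrt_pos.2 (by positivity : 0 < y / δ))
      rw [Real.log_sqrt (by positivity)] at h2
      linarith
    have h3 : δ * Real.sqrt (y / δ) ≤ s * y := by
      rw [← Real.sqrt_sq (by positivity : 0 ≤ s * y), ← Real.sqrt_sq hδ0.le,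
        ← Real.sqrt_mul (by positivity), Real.sqrt_sq hδ0.le]
      refine Real.sqrt_le_sqrt ?_
      have : δ ^ 2 * (y / δ) = δ * y := by field_simp
      rw [this]
      nlinarith
    nlinarith
  have hlog3 : δ * (Real.log Λ + Λ) ≤ 2 * s ^ 2 * ε := by
    have h1 : Real.log Λ ≤ Λ := (Real.log_le_sub_one_of_pos hΛ0).trans (by linarith)
    calc δ * (Real.log Λ + Λ) ≤ (s ^ 2 * y) * (Λ + Λ) := by
          refine (mul_le_mul_of_nonneg_left (by linarith) hδ0.le).trans
            (mul_le_mul_of_nonneg_right hδy (by linarith))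
      _ = 2 * s ^ 2 * (y * Λ) := by ring
      _ = _ := by rw [hyΛ]
  have htau : tau δ d ≤ 2 * d + 2 * Real.log (1 / δ) := by
    have h1 : 0 ≤ Real.log d + Real.log (1 / δ) := add_nonneg (Real.log_nonneg hd1)
      (Real.log_nonneg (by rwa [le_div_iff₀ hδ0, one_mul]))
    have h2 : Real.log d ≤ d := (Real.log_le_sub_one_of_pos (by linarith)).trans (by linarith)
    have h3 : tau δ d = (Real.log d + Real.log (1 / δ)) / Real.log 2 := by
      unfold tau Real.logb; ring
    rw [h3, div_le_iff₀ (Real.log_pos (by norm_num))]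
    have := Real.log_two_gt_d9
    nlinarith
  have hfinal : δ * (1 + tau δ d) ≤ s * ε * (14 + 4 * d) := by
    have h1 : δ * (1 + tau δ d) ≤ δ * (1 + 2 * d) + 2 * (δ * Real.log (1 / δ)) := by
      have := mul_le_mul_of_nonneg_left htau hδ0.le
      linarith
    have h2 : δ * Real.log (1 / δ) ≤ 2 * (s * y) + 2 * s ^ 2 * ε := by
      rw [hlog1, mul_add]; linarith
    have h3 : s * y ≤ 2 * (s * ε) := by nlinarith
    have h4 : s ^ 2 * ε ≤ s * ε := by gcongr
    have h5 : δ ≤ 2 * (s * ε) := by nlinarith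
    have h6 : δ * (1 + 2 * d) ≤ 2 * (s * ε) * (1 + 2 * d) := by gcongr
    linarith
  calc M * (δ * (1 + tau δ d)) ≤ M * (s * ε * (14 + 4 * d)) := by gcongr
    _ = (M * (14 + 4 * d)) / (M * (14 + 4 * d) + 1) * ε := by rw [hs]; ring
    _ ≤ 1 * ε := by
        refine mul_le_mul_of_nonneg_right ?_ hε.le
        rw [div_le_one (by positivity)]; linarith
    _ = ε := one_mul ε

/-! ### Markov's inequality -/

theorem measureReal_lt_le_of_integral_le {Ω : Type*} [MeasurableSpace Ω] {μ : Measure Ω}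
    [IsProbabilityMeasure μ] {X : Ω → ℝ} (hX : ∀ u, 0 ≤ X u) (hint : Integrable X μ) {a : ℝ}
    (ha : 9 * ∫ u, X u ∂μ ≤ a) : μ.real {u | a < X u} ≤ 1 / 9 := by
  have hI : 0 ≤ ∫ u, X u ∂μ := integral_nonneg hX
  rcases hI.eq_or_lt with h0 | h0
  -- When the mean vanishes `a` may be zero (for instance at zero cost), where Markov's inequality
  -- says nothing.
  · have hae : X =ᵐ[μ] 0 := (integral_eq_zero_iff_of_nonneg hX hint).1 h0.symm
    have : μ {u | a < X u} = 0 := by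
      refine measure_mono_null (fun u hu => ?_) (ae_iff.1 hae)
      have hu' : a < X u := hu
      have : 0 < X u := by linarith
      exact this.ne'
    rw [Measure.real, this]
    simp
  · have ha0 : 0 < a := by linarith
    have h1 := mul_meas_ge_le_integral_of_nonneg (μ := μ) (Filter.Eventually.of_forall hX) hint a
    have h2 : μ.real {u | a < X u} ≤ μ.real {u | a ≤ X u} :=
      measureReal_mono fun u (hu : a < X u) => hu.le
    have h3 : a * μ.real {u | a < X u} ≤ a * (1 / 9) := by nlinarith
    exact le_of_mul_le_mul_left h3 ha0

theorem exists_measurableSet_of_integral_le {Ω : Type*} [MeasurableSpace Ω] {μ : Measure Ω}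
    [IsProbabilityMeasure μ] {X Y Z : Ω → ℝ} (hX : ∀ u, 0 ≤ X u) (hY : ∀ u, 0 ≤ Y u)
    (hZ : ∀ u, 0 ≤ Z u) (hXi : Integrable X μ) (hYi : Integrable Y μ) (hZi : Integrable Z μ)
    {a b c : ℝ} (ha : 9 * ∫ u, X u ∂μ ≤ a) (hb : 9 * ∫ u, Y u ∂μ ≤ b)
    (hc : 9 * ∫ u, Z u ∂μ ≤ c) :
    ∃ G : Set Ω, MeasurableSet G ∧ 2 / 3 ≤ μ.real G ∧ ∀ u ∈ G, X u ≤ a ∧ Y u ≤ b ∧ Z u ≤ c := by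
  set E : Set Ω := {u | a < X u} ∪ {u | b < Y u} ∪ {u | c < Z u}
  have hE : μ.real E ≤ 1 / 3 := by
    have h1 := measureReal_union_le (μ := μ) ({u | a < X u} ∪ {u | b < Y u}) {u | c < Z u}
    have h2 := measureReal_union_le (μ := μ) {u | a < X u} {u | b < Y u}
    have h3 := measureReal_lt_le_of_integral_le hX hXi ha
    have h4 := measureReal_lt_le_of_integral_le hY hYi hb
    have h5 := measureReal_lt_le_of_integral_le hZ hZi hc
    linarith
  -- Passing to a measurable hull of the bad event keeps its measure and yields a measurable good
  -- set.
  refine ⟨(toMeasurable μ E)ᶜ, (measurableSet_toMeasurable μ E).compl, ?_, fun u hu => ?_⟩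
  · rw [probReal_compl_eq_one_sub (measurableSet_toMeasurable μ E), Measure.real,
      measure_toMeasurable]
    change 2 / 3 ≤ 1 - μ.real E
    linarith
  · have hu' : u ∉ E := fun h => hu (subset_toMeasurable μ E h)
    simp only [E, Set.mem_union, Set.mem_ofPred_eq, not_or, not_lt] at hu'
    exact ⟨hu'.1.1, hu'.1.2, hu'.2⟩

/-! ### The structure theorem -/

/-- If `ε m / 2 < 1`, the floor vanishes but so does the integer `n`. Otherwise the floor is at
least half its argument; hence `144 = 2 * 2 * 36`. -/
theorem mul_le_card_of_le_floor {n h : ℕ} {ε m : ℝ} (hh : h = ⌊ε * m / 2⌋₊)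
    (hn : (n : ℝ) ≤ ε / 144 * m) : 36 * n ≤ h := by
  rcases lt_or_ge (ε * m / 2) 1 with h1 | h1
  · have : (n : ℝ) < 1 := by linarith
    have : n = 0 := by
      have : n < 1 := by exact_mod_cast this
      omega
    omega
  · have h2 : 1 ≤ h := by rw [hh]; exact (Nat.one_le_floor_iff _).2 h1
    have h3 := Nat.lt_floor_add_one (ε * m / 2)
    rw [← hh] at h3
    have h4 : (1 : ℝ) ≤ h := by exact_mod_cast h2
    have h5 : (36 * n : ℝ) ≤ h := by linarith
    exact_mod_cast h5

/-- Small distortion holds once the three random quantities that control it are small. -/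
theorem smallDistortion_of_bounds {d : ℕ} (hd : 0 < d) {bot top : ℤ} {u : Fin d → ℝ} {ε ρ : ℝ}
    (hρ : 0 < ρ) {P Cand O A O' : Finset (Pt d)} {k : ℕ} {α β γ : Pt d → Pt d}
    (hO : IsSolution Cand k O) (hA : IsSolution Cand k A) (hα : IsNearestMap A α)
    (hβ : IsNearestMap O β) (hγ : IsNearestMap O' γ) (hT : IsTrimmed 18 ε P O A α O')
    (hX : ∑ p ∈ P, budgetBound d top (2 * ρ) A O' α p u ≤ ε * (cost P O + cost P A))
    (hY : ∑ l ∈ A with (fiber O α l).card ≠ 1, badCount d top (2 * ρ) l (3 * distTo O' l) u ≤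
      ε / 144 * (multi O α).card)
    (hZ : ∑ p ∈ P, moveBound d top (2 * ρ) O A O' α (β p) (γ p) p u ≤
      ε / 2 * (cost P O + cost P A)) :
    SmallDistortion (quadtree d bot top u) ε (2 * ρ) ρ P Cand k O O' A α := by
  classical
  set D := quadtree d bot top u
  refine ⟨(Finset.sum_le_sum fun p _ =>
    budget_le_budgetBound hd (by positivity) A O' α p u).trans hX, ?_⟩
  obtain ⟨H, hHm, hO'H, hHc, -, hcost⟩ := hT
  set B := badCenters D (2 * ρ) A O' with hBdef
  have hBA : B ⊆ A := Finset.filter_subset _ _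
  have hbad0 : ∀ l, 0 ≤ badCount d top (2 * ρ) l (3 * distTo O' l) u := fun l =>
    badCount_nonneg hd _ _ _ (by have := distTo_nonneg O' l; positivity) _
  have hnX : ((B.filter fun l => (fiber O α l).card ≠ 1).card : ℝ) ≤
      ε / 144 * (multi O α).card := by
    refine le_trans ?_ hY
    have h1 : ((B.filter fun l => (fiber O α l).card ≠ 1).card : ℝ) ≤
        ∑ l ∈ B.filter fun l => (fiber O α l).card ≠ 1,
          badCount d top (2 * ρ) l (3 * distTo O' l) u := by
      rw [Finset.card_eq_sum_ones, Nat.cast_sum, Nat.cast_one]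
      refine Finset.sum_le_sum fun l hl => ?_
      exact one_le_badCount hd (Finset.mem_filter.1 (Finset.mem_filter.1 hl).1).2
    exact h1.trans (Finset.sum_le_sum_of_subset_of_nonneg (Finset.filter_subset_filter _ hBA)
      fun l _ _ => hbad0 l)
  have hn36 := mul_le_card_of_le_floor hHc hnX
  have hO'O : O' ⊆ O := hO'H ▸ Finset.sdiff_subset
  -- The weight of an optimal center is what its clients lose when served by `O'` instead. Choosing
  -- the lightest part of `H` for this weight turns the loss `18 ε` of trimming into `18 ε / 36 = ε
  -- / 2`.
  let w : Pt d → ℝ := fun f => ∑ p ∈ P with β p = f, (distTo O' p ^ 2 - distTo O p ^ 2)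
  have hw0 : ∀ p, 0 ≤ distTo O' p ^ 2 - distTo O p ^ 2 := fun p => sub_nonneg.2
    (pow_le_pow_left₀ (distTo_nonneg _ _) (distTo_anti ⟨γ p, (hγ p).1⟩ hO'O p) 2)
  obtain ⟨S, H₁, hS, hBS, hH₁, hw, hex⟩ := exists_exchange hO hA hBA hHm (by omega) w
  have hH : ∀ f ∈ O', f ∉ H₁ := fun f hf hf' => by
    rw [hO'H] at hf
    exact (Finset.mem_sdiff.1 hf).2 (hH₁ hf')
  have hnear : ∀ x, ∃ t ∈ S, dist x t ≤ 2 * distTo O' x + distTo A x := by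
    intro x
    rcases hex (γ x) (hO'O (hγ x).1) (hH _ (hγ x).1) with h | h
    · refine ⟨γ x, h, ?_⟩
      rw [← hγ.distTo_eq x]
      linarith [distTo_nonneg O' x, distTo_nonneg A x]
    · refine ⟨α (γ x), hBS h, ?_⟩
      rw [hγ.distTo_eq x]
      exact hα.dist_map_le x (γ x)
  refine ⟨S, hS, hBS, ?_, fun p _ => exists_detour_le_budget hd hρ hα hBS hnear p⟩
  have hsum := Finset.sum_le_sum fun p (_ : p ∈ P) =>
    moved_cost_le hd hα hβ hγ hO'O hH hBS hex hnear p
  rw [Finset.sum_add_distrib, Finset.sum_add_distrib, ← Finset.sum_filter] at hsum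
  have hdiff : ∑ p ∈ P, (distTo O' p ^ 2 - distTo O p ^ 2) ≤
      18 * ε * (cost P O + cost P A) := by
    rw [Finset.sum_sub_distrib]
    change cost P O' - cost P O ≤ _
    linarith
  have hH₁w : ∑ p ∈ P with β p ∈ H₁, (distTo O' p ^ 2 - distTo O p ^ 2) ≤
      ε / 2 * (cost P O + cost P A) := by
    have hPw : 0 ≤ ∑ p ∈ P, (distTo O' p ^ 2 - distTo O p ^ 2) :=
      Finset.sum_nonneg fun p _ => hw0 p
    suffices h : ∑ p ∈ P with β p ∈ H₁, (distTo O' p ^ 2 - distTo O p ^ 2) ≤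
        1 / 36 * ∑ p ∈ P, (distTo O' p ^ 2 - distTo O p ^ 2) by linarith
    rcases Nat.eq_zero_or_pos H.card with h0 | h0
    · have : H₁ = ∅ := Finset.subset_empty.1 (by rwa [Finset.card_eq_zero.1 h0] at hH₁)
      rw [this]
      simpa using hPw
    · have h0' : (0 : ℝ) < H.card := by exact_mod_cast h0
      simp only [w, Finset.sum_fiberwise_eq_sum_filter] at hw
      refine le_of_mul_le_mul_right (hw.trans ?_) h0'
      have h1 : ∑ p ∈ P with β p ∈ H, (distTo O' p ^ 2 - distTo O p ^ 2) ≤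
          ∑ p ∈ P, (distTo O' p ^ 2 - distTo O p ^ 2) :=
        Finset.sum_le_sum_of_subset_of_nonneg (Finset.filter_subset _ _) fun p _ _ => hw0 p
      have h2 : ((B.filter fun l => (fiber O α l).card ≠ 1).card : ℝ) ≤ 1 / 36 * H.card := by
        have : (36 * (B.filter fun l => (fiber O α l).card ≠ 1).card : ℝ) ≤ H.card := by
          exact_mod_cast hn36
        linarith
      calc _ ≤ (1 / 36 * H.card : ℝ) * ∑ p ∈ P, (distTo O' p ^ 2 - distTo O p ^ 2) := by
            gcongr
            exact Finset.sum_nonneg fun p _ => hw0 p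
        _ = _ := by ring
  change _ ≤ cost P O + _ + _ at hsum
  linarith

theorem exists_shifts_smallDistortion {d : ℕ} (hd : 0 < d) (bot top : ℤ) {ε ρ : ℝ} (hε : 0 < ε)
    (hε2 : ε ≤ 1 / 2) (hρ : 0 < ρ) (hρ1 : 2 * ρ ≤ 1)
    (hpar : 90 * ((90 * (1 + d) + 36) * d * Real.sqrt d) * (2 * ρ * (1 + tau (2 * ρ) d)) ≤ ε)
    {P Cand O A O' : Finset (Pt d)} {k : ℕ} {α : Pt d → Pt d} (hk : 0 < k)
    (hO : IsSolution Cand k O) (hA : IsSolution Cand k A) (hα : IsNearestMap A α)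
    (hT : IsTrimmed 18 ε P O A α O') :
    ∃ G : Set (Fin d → ℝ), MeasurableSet G ∧ 2 / 3 ≤ (shiftLaw d).real G ∧
      ∀ u ∈ G, SmallDistortion (quadtree d bot top u) ε (2 * ρ) ρ P Cand k O O' A α := by
  classical
  have hδ : 0 < 2 * ρ := by positivity
  have hd1 : (1 : ℝ) ≤ d := by exact_mod_cast hd
  have hτ := tau_nonneg hd hδ hρ1
  have hOne : O.Nonempty := Finset.card_pos.1 (by rw [hO.2]; exact hk)
  have hO'ne : O'.Nonempty := by
    obtain ⟨H, -, hO'H, -, hkeep, -⟩ := hT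
    obtain ⟨f, hf⟩ := hOne
    obtain ⟨g, hg, hgH, -⟩ := hkeep (α f) (hα f).1 ⟨f, mem_fiber.2 ⟨hf, rfl⟩⟩
    exact ⟨g, hO'H ▸ Finset.mem_sdiff.2 ⟨(mem_fiber.1 hg).1, hgH⟩⟩
  obtain ⟨β, hβ⟩ := exists_isNearestMap hOne
  obtain ⟨γ, hγ⟩ := exists_isNearestMap hO'ne
  have hcO : 0 ≤ cost P O := Finset.sum_nonneg fun p _ => sq_nonneg _
  have hcA : 0 ≤ cost P A := Finset.sum_nonneg fun p _ => sq_nonneg _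
  have hcost : cost P O' ≤ 10 * cost P O + 9 * cost P A := by
    obtain ⟨H, -, -, -, -, h⟩ := hT
    nlinarith
  have hr : ∀ l, 0 ≤ 3 * distTo O' l := fun l => by have := distTo_nonneg O' l; positivity
  have hXi := fun p => integrable_integral_budgetBound_le hd top hδ hτ A O' hα p
  have hYi := fun l => integrable_badCount hd top (2 * ρ) l (hr l)
  have hZi := fun p => integrable_integral_moveBound_le hd top hδ O A O' α (β p) (γ p) p
  set K := (90 * (1 + d) + 36) * d * Real.sqrt d with hK
  have hsd : 1 ≤ Real.sqrt d := Real.one_le_sqrt.2 hd1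
  have hKs : 216 * Real.sqrt d ≤ K := by
    have : (216 : ℝ) * 1 ≤ (90 * (1 + d) + 36) * d := by gcongr; linarith
    rw [hK]
    nlinarith
  have hsδ : 19440 * (Real.sqrt d * (2 * ρ)) ≤ ε := by
    refine le_trans ?_ hpar
    calc 19440 * (Real.sqrt d * (2 * ρ)) = 90 * (216 * Real.sqrt d) * (2 * ρ * (1 + 0)) := by ring
      _ ≤ _ := by gcongr
  have hsδ0 : 0 ≤ Real.sqrt d * (2 * ρ) := by positivity
  set W := cost P O + cost P A with hW
  -- The moving cost gets `ε / 2`, since the other half of the allowed increase is spent on `H₁`.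
  -- The factor 90 in the parameter is 9 from Markov times 10 from `cost P A + cost P O' ≤ 10 W`.
  obtain ⟨G, hG, hGm, hGu⟩ := exists_measurableSet_of_integral_le (μ := shiftLaw d)
    (X := fun u => ∑ p ∈ P, budgetBound d top (2 * ρ) A O' α p u)
    (Y := fun u => ∑ l ∈ A with (fiber O α l).card ≠ 1,
      badCount d top (2 * ρ) l (3 * distTo O' l) u)
    (Z := fun u => ∑ p ∈ P, moveBound d top (2 * ρ) O A O' α (β p) (γ p) p u)
    (a := ε * W) (b := ε / 144 * (multi O α).card) (c := ε / 2 * W)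
    (fun u => Finset.sum_nonneg fun p _ => budgetBound_nonneg hd hδ A O' α p u)
    (fun u => Finset.sum_nonneg fun l _ => badCount_nonneg hd _ _ _ (hr l) _)
    (fun u => Finset.sum_nonneg fun p _ => moveBound_nonneg hd _ _ _ _ _ _ _ _ _ _)
    (integrable_finsetSum _ fun p _ => (hXi p).1) (integrable_finsetSum _ fun l _ => hYi l)
    (integrable_finsetSum _ fun p _ => (hZi p).1)
    (by
      rw [integral_finsetSum _ fun p _ => (hXi p).1]
      have h1 := Finset.sum_le_sum fun p (_ : p ∈ P) => (hXi p).2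
      rw [← Finset.mul_sum, Finset.sum_add_distrib] at h1
      change _ ≤ _ * (cost P A + cost P O') at h1
      have h2 : cost P A + cost P O' ≤ 10 * W := by linarith
      have h3 : 0 ≤ K * (2 * ρ * (1 + tau (2 * ρ) d)) := by positivity
      have h4 := mul_le_mul_of_nonneg_left h2 h3
      have h5 := mul_le_mul_of_nonneg_right hpar (by positivity : 0 ≤ W)
      linarith)
    (by
      rw [integral_finsetSum _ fun l _ => hYi l]
      have h1 := Finset.sum_le_card_nsmul _ _ _ fun l
        (_ : l ∈ A.filter fun l => (fiber O α l).card ≠ 1) =>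
          integral_badCount_le hd top hδ l (hr l)
      rw [card_filter_fiber_ne_one hα (hO.2.trans hA.2.symm), nsmul_eq_mul] at h1
      have h2 := mul_le_mul_of_nonneg_right hsδ (Nat.cast_nonneg (α := ℝ) (multi O α).card)
      have h3 := mul_nonneg hsδ0 (Nat.cast_nonneg (α := ℝ) (multi O α).card)
      linarith)
    (by
      rw [integral_finsetSum _ fun p _ => (hZi p).1]
      have h1 := Finset.sum_le_sum fun p (_ : p ∈ P) => (hZi p).2
      rw [← Finset.mul_sum, Finset.sum_add_distrib, Finset.sum_add_distrib] at h1
      change _ ≤ _ * (cost P O + cost P A + cost P O') at h1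
      have h2 : cost P O + cost P A + cost P O' ≤ 11 * W := by linarith
      have h4 := mul_le_mul_of_nonneg_left h2 hsδ0
      have h5 := mul_le_mul_of_nonneg_right hsδ (by positivity : 0 ≤ W)
      have h6 := mul_nonneg hsδ0 (by positivity : 0 ≤ W)
      linarith)
  exact ⟨G, hG, hGm, fun u hu => smallDistortion_of_bounds hd hρ hO hA hα hβ hγ hT
    (hGu u hu).1 (hGu u hu).2.1 (hGu u hu).2.2⟩

end QT

theorem theorem3 :
    ∃ C : ℝ, 0 < C ∧ ∀ d : ℕ, 0 < d → ∃ c K : ℝ, 0 < c ∧ 0 < K ∧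
      ∀ ε ρ : ℝ, 0 < ε → ε ≤ 1 / 2 → 0 < ρ → ρ ≤ c * (ε / Real.log (1 / ε)) →
      ∀ bot top : ℤ, bot ≤ top →
        (∀ u : Fin d → ℝ, QT.GoodPortals d bot top u ρ K) ∧
        ∀ (P Cand : Finset (QT.Pt d)) (k : ℕ) (OPT A : Finset (QT.Pt d)) (α : QT.Pt d → QT.Pt d),
          0 < k → QT.IsOptimal P Cand k OPT → QT.IsSolution Cand k A → QT.IsNearestMap A α →
          (∃ OPT', QT.IsTrimmed C ε P OPT A α OPT') ∧
          ∀ OPT', QT.IsTrimmed C ε P OPT A α OPT' →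
            ∃ G : Set (Fin d → ℝ), MeasurableSet G ∧ 2 / 3 ≤ (QT.shiftLaw d).real G ∧
              ∀ u ∈ G, QT.SmallDistortion (QT.quadtree d bot top u) ε (2 * ρ) ρ
                P Cand k OPT OPT' A α := by
  refine ⟨18, by norm_num, fun d hd => ?_⟩
  have hd0 : (0 : ℝ) < d := by exact_mod_cast hd
  obtain ⟨c, hc, hpar⟩ := QT.exists_parameter hd
    (by positivity : 0 < 90 * ((90 * (1 + d) + 36) * d * Real.sqrt d))
  refine ⟨c, 2 * d * 3 ^ (d - 1), hc, by positivity, fun ε ρ hε hε2 hρ hρc bot top _ => ?_⟩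
  obtain ⟨hρ1, hM⟩ := hpar ε ρ hε hε2 hρ hρc
  refine ⟨fun u => QT.goodPortals hd bot top u hρ (by linarith),
    fun P Cand k OPT A α hk hOPT hA hα => ⟨?_, fun OPT' hT => ?_⟩⟩
  · exact QT.exists_isTrimmed hε (by linarith) P OPT A hα
      (Finset.card_pos.1 (by rw [hOPT.1.2]; exact hk))
  · exact QT.exists_shifts_smallDistortion hd bot top hε hε2 hρ hρ1 hM hk hOPT.1 hA hα hT
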